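/- All rings are commutative and noetherian and all modules are finitely generated. For a ring $R$, let $\mathrm{G}(R)$ be the Grothendieck group of $R$-modules, and let $\mathrm{h}(R)$ be the quotient of $\mathrm{G}(R)$ by the subgroup generated by the classes of pseudo-zero modules, i.e. modules $M$ with $M_{\mathfrak p}=0$ for every prime $\mathfrak p$ of height at most one; put $\mathrm{h}(R)_{\mathbb R}=\mathrm{h}(R)\otimes_{\mathbb Z}\mathbb R$. An $R$-module $M$ is maximal Cohen–Macaulay (MCM) if $\operatorname{depth}M_{\mathfrak p}\ge\operatorname{ht}\mathfrak p$ for all primes $\mathfrak p$ (with $\operatorname{depth}0=\infty$), and $\mathrm{c}(R)=\sum_{M\ \mathrm{MCM}}\mathbb R_{\ge0}[M]\subseteq\mathrm{h}(R)_{\mathbb R}$. A convex cone is polyhedral if it is spanned by finitely many vectors. A module $M$ is locally free in codimension one if $M_{\mathfrak p}$ is free for all primes $\mathfrak p$ of height one. When $R$ is local, $\Omega^n_RM$ and $\beta_n^R(M)$ denote the $n$th syzygy and the $n$th Betti number in the minimal free resolution of $M$, and the complexity $\operatorname{cx}_RM\in\mathbb N\cup\{\infty\}$ is the infimum of the integers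 $n\ge0$ for which there is a real number $\alpha\ge0$ with $\beta_i^R(M)\le\alpha\, i^{\,n-1}$ for all $i\gg0$. **Theorem.** Let $R\subseteq S$ be a finite extension of Cohen–Macaulay local domains. Suppose that $R$ is normal, that $\mathrm{h}(S)_{\mathbb R}$ is finite-dimensional, and that $\mathrm{c}(S)$ is polyhedral. Let $f:\mathrm{h}(S)_{\mathbb R}\to\mathrm{h}(R)_{\mathbb R}$ be the natural $\mathbb R$-linear map sending the class of an $S$-module $X$ to the class of $X$ regarded as an $R$-module, and put $V=f(\mathrm{c}(S))$. Then $f$ is surjective and $V$ is a polyhedral subcone of $\mathrm{c}(R)$. Moreover, let $M$ be an $R$-module with $\operatorname{cx}_RM\ge2$ which is locally free in codimension one. Then $[\Omega_R^nM]\in V$ for infinitely many $n\in\mathbb N$, if either of the following two conditions holds. 1. There exists an $S$-module $N$, locally free in codimension one as an $R$-module, such that $[N\oplus N^*]$ lies in the interior of $\mathrm{c}(S)$ in $\mathrm{h}(S)_{\mathbb R}$, where $N^*=\operatorname{Hom}_R(N,R)$ is regarded as an $S$-module. 2. The $R$-module $\operatorname{Hom}_R(S,R)$ is maximal Cohen–Macaulay.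 -/

import Mathlib

universe u

namespace GrothendieckCone

/-! ### The Grothendieck group modulo pseudo-zero modules -/

section Groups

variable (R : Type u) [CommRing R]

/-- The defining relations `[M₂] - [M₁] - [M₃]` of the Grothendieck group, one for each short exact
sequence `0 → M₁ → M₂ → M₃ → 0` of finitely generated modules. -/
def exactRelations : Set (FreeAbelianGroup (FGModuleCat.{u} R)) :=
  {x | ∃ (M₁ M₂ M₃ : FGModuleCat.{u} R) (f : M₁ →ₗ[R] M₂) (g : M₂ →ₗ[R] M₃),
    Function.Injective f ∧ Function.Exact f g ∧ Function.Surjective g ∧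
    x = FreeAbelianGroup.of M₂ - FreeAbelianGroup.of M₁ - FreeAbelianGroup.of M₃}

/-- The Grothendieck group `G(R)` of finitely generated `R`-modules. -/
abbrev G : Type (u + 1) :=
  FreeAbelianGroup (FGModuleCat.{u} R) ⧸ AddSubgroup.closure (exactRelations R)

/-- The class of a finitely generated module in `G(R)`. -/
def gClass (M : FGModuleCat.{u} R) : G R :=
  QuotientAddGroup.mk' (AddSubgroup.closure (exactRelations R)) (FreeAbelianGroup.of M)

/-- A module is pseudo-zero if its localization at every prime of height at most one vanishes. -/
def IsPseudoZero (M : Type*) [AddCommGroup M] [Module R M] : Prop :=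
  ∀ (p : Ideal R) [p.IsPrime], p.height ≤ 1 → Subsingleton (LocalizedModule p.primeCompl M)

/-- The subgroup of `G(R)` generated by the classes of pseudo-zero modules. -/
def pseudoZeroSubgroup : AddSubgroup (G R) :=
  AddSubgroup.closure {x | ∃ M : FGModuleCat.{u} R, IsPseudoZero R M ∧ x = gClass R M}

/-- The group `H(R)`: the quotient of `G(R)` by the subgroup generated by pseudo-zero modules. -/
abbrev H : Type (u + 1) := G R ⧸ pseudoZeroSubgroup R

/-- The class of a finitely generated module in `H(R)`. -/
def hClass (M : FGModuleCat.{u} R) : H R :=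
  QuotientAddGroup.mk' (pseudoZeroSubgroup R) (gClass R M)

/-- The real vector space `H(R)_ℝ = ℝ ⊗_ℤ H(R)`. -/
abbrev HReal : Type (u + 1) := TensorProduct ℤ ℝ (H R)

/-- The class of a finitely generated module in `H(R)_ℝ`. -/
noncomputable def realClass (M : Type u) [AddCommGroup M] [Module R M] [Module.Finite R M] :
    HReal R :=
  TensorProduct.tmul ℤ (1 : ℝ) (hClass R (FGModuleCat.of R M))

end Groups

/-! ### Depth, maximal Cohen-Macaulay modules, and the Cohen-Macaulay cone -/

section CohenMacaulay

/-- The depth of a finitely generated module over a noetherian local ring: the supremum of the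
lengths of the weakly regular sequences contained in the maximal ideal. For a nonzero module these
are the regular sequences, by Nakayama; the zero module has depth `∞`. -/
noncomputable def depth (A : Type*) [CommRing A] [IsLocalRing A] (M : Type*) [AddCommGroup M]
    [Module A M] : ℕ∞ :=
  ⨆ (rs : List A) (_ : (∀ r ∈ rs, r ∈ IsLocalRing.maximalIdeal A) ∧
    RingTheory.Sequence.IsWeaklyRegular M rs), (rs.length : ℕ∞)

variable (R : Type u) [CommRing R]

/-- A finitely generated module `M` is maximal Cohen-Macaulay if `depth M_p ≥ height p` for all
prime ideals `p`. -/
def IsMCM (M : Type*) [AddCommGroup M] [Module R M] : Prop :=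
  ∀ (p : Ideal R) [p.IsPrime],
    p.height ≤ depth (Localization.AtPrime p) (LocalizedModule p.primeCompl M)

/-- A noetherian ring is Cohen-Macaulay if each of its localizations at a prime ideal is a
Cohen-Macaulay local ring, that is, has depth equal to its dimension. -/
def IsCohenMacaulay : Prop :=
  ∀ (p : Ideal R) [p.IsPrime], depth (Localization.AtPrime p) (Localization.AtPrime p) = p.height

/-- The cone `C(R) = ∑ ℝ≥0 [M]` in `H(R)_ℝ` spanned by the maximal Cohen-Macaulay modules. -/
noncomputable def cmCone : PointedCone ℝ (HReal R) :=
  PointedCone.hull ℝ {x | ∃ M : FGModuleCat.{u} R, IsMCM R M ∧ x = realClass R M}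

/-- A convex cone is polyhedral if it is spanned by finitely many vectors. -/
def IsPolyhedral {E : Type*} [AddCommGroup E] [Module ℝ E] (C : PointedCone ℝ E) : Prop :=
  ∃ t : Finset E, C = PointedCone.hull ℝ (t : Set E)

/-- The interior of a cone in a finite-dimensional real vector space. On such a space the module
topology is the Euclidean topology given by any choice of a basis. -/
def coneInterior {E : Type*} [AddCommGroup E] [Module ℝ E] (C : PointedCone ℝ E) : Set E :=
  letI : TopologicalSpace E := moduleTopology ℝ E
  interior (C : Set E)

/-- A module `M` is locally free in codimension one if `M_p` is free for all primes `p` of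
height one. -/
def IsLocallyFreeInCodimOne (M : Type*) [AddCommGroup M] [Module R M] : Prop :=
  ∀ (p : Ideal R) [p.IsPrime], p.height = 1 →
    Module.Free (Localization.AtPrime p) (LocalizedModule p.primeCompl M)

end CohenMacaulay

/-! ### Minimal free resolutions, Betti numbers and complexity -/

section Syzygies

variable (R : Type u) [CommRing R]

/-- The minimal number of generators of a finitely generated module. -/
noncomputable def minGen (M : FGModuleCat.{u} R) : ℕ := (⊤ : Submodule R M).spanFinrank

theorem exists_minimalGenerators (M : FGModuleCat.{u} R) :
    ∃ x : Fin (minGen R M) → M, Submodule.span R (Set.range x) = ⊤ := by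
  obtain ⟨s, hs, hsp⟩ := Submodule.FG.exists_span_finset_card_eq_spanFinrank
    (Module.Finite.fg_top (R := R) (M := M))
  refine ⟨fun i => (s.equivFinOfCardEq hs).symm i, ?_⟩
  refine Eq.trans (congrArg (Submodule.span R) (Set.ext fun y => ?_)) hsp
  constructor
  · rintro ⟨i, rfl⟩
    exact ((s.equivFinOfCardEq hs).symm i).2
  · intro hy
    exact ⟨s.equivFinOfCardEq hs ⟨y, hy⟩,
      congrArg Subtype.val ((s.equivFinOfCardEq hs).symm_apply_apply ⟨y, hy⟩)⟩

/-- A minimal system of generators. -/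
noncomputable def minimalGenerators (M : FGModuleCat.{u} R) : Fin (minGen R M) → M :=
  (exists_minimalGenerators R M).choose

/-- The free cover `R^μ → M` given by a minimal system of generators. Over a local ring this is
the (unique up to isomorphism) minimal free cover. -/
noncomputable def minimalCover (M : FGModuleCat.{u} R) : (Fin (minGen R M) → R) →ₗ[R] M :=
  Fintype.linearCombination R (minimalGenerators R M)

variable [IsNoetherianRing R]

/-- The first syzygy: the kernel of the minimal free cover. -/
noncomputable def firstSyzygy (M : FGModuleCat.{u} R) : FGModuleCat.{u} R :=
  FGModuleCat.of R (LinearMap.ker (minimalCover R M))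

/-- The `n`-th syzygy `Ωⁿ M`. Over a local ring, splicing the sequences
`0 → Ωⁿ⁺¹ M → R^(β n) → Ωⁿ M → 0` gives the minimal free resolution of `M`. -/
noncomputable def syzygy (n : ℕ) (M : FGModuleCat.{u} R) : FGModuleCat.{u} R :=
  (firstSyzygy R)^[n] M

/-- The `n`-th Betti number of `M`: the rank of the `n`-th free module in the minimal free
resolution. -/
noncomputable def betti (n : ℕ) (M : FGModuleCat.{u} R) : ℕ := minGen R (syzygy R n M)

/-- The complexity of `M`: the infimum of the `n ≥ 0` for which there is a real `α ≥ 0` with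
`β i ≤ α * i ^ (n - 1)` for all sufficiently large `i`. It is `∞` if there is no such `n`. -/
noncomputable def complexity (M : FGModuleCat.{u} R) : ℕ∞ :=
  ⨅ (n : ℕ) (_ : ∃ α : ℝ, 0 ≤ α ∧ ∀ᶠ i : ℕ in Filter.atTop,
    (betti R i M : ℝ) ≤ α * (i : ℝ) ^ ((n : ℤ) - 1)), (n : ℕ∞)

end Syzygies

/-! ### Restriction of scalars along a finite extension -/

section Extension

variable (R S : Type u) [CommRing R] [CommRing S] [Algebra R S]

/-- An `S`-module regarded as an `R`-module through the structure map `R → S`. -/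
def restrictObj [Module.Finite R S] (X : FGModuleCat.{u} S) : FGModuleCat.{u} R :=
  letI : Module R X := Module.compHom X (algebraMap R S)
  haveI : IsScalarTower R S X :=
    IsScalarTower.of_algebraMap_smul fun _ _ => rfl
  haveI : Module.Finite R X := Module.Finite.trans S X
  FGModuleCat.of R X

theorem height_le_height_comap [Algebra.IsIntegral R S] (q : Ideal S) [q.IsPrime] :
    q.height ≤ (q.comap (algebraMap R S)).height := by
  have h := Order.height_le_height_apply_of_strictMono (PrimeSpectrum.comap (algebraMap R S))
    (fun I J h => Ideal.IsIntegral.comap_lt_comap (I := I.asIdeal) (J := J.asIdeal) h) ⟨q, ‹_›⟩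
  rwa [← PrimeSpectrum.height_eq_orderHeight, ← PrimeSpectrum.height_eq_orderHeight] at h

theorem IsPseudoZero.restrict [Module.Finite R S] (X : FGModuleCat.{u} S)
    (hX : IsPseudoZero S X) : IsPseudoZero R (restrictObj R S X) := by
  intro p hp hht
  by_contra hne
  rw [not_subsingleton_iff_nontrivial] at hne
  have hsupp : (⟨p, hp⟩ : PrimeSpectrum R) ∈ Module.support R (restrictObj R S X) := hne
  have hann : Module.annihilator R (restrictObj R S X) ≤ p :=
    Module.annihilator_le_of_mem_support hsupp
  have hle : (Module.annihilator S X).comap (algebraMap R S) ≤ p := by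
    refine le_trans ?_ hann
    intro r hr
    rw [Module.mem_annihilator]
    intro x
    exact Module.mem_annihilator.mp (Ideal.mem_comap.mp hr) (show (X : Type u) from x)
  obtain ⟨q, hq, hqp, hqc⟩ := Ideal.exists_ideal_over_prime_of_isIntegral p _ hle
  have h1 : q.height ≤ 1 := by
    refine (height_le_height_comap R S q).trans ?_
    rwa [hqc]
  have h2 : (⟨q, hqp⟩ : PrimeSpectrum S) ∈ Module.support S X :=
    Module.mem_support_iff_of_finite.mpr hq
  have h3 : Nontrivial (LocalizedModule q.primeCompl X) := h2
  exact not_subsingleton_iff_nontrivial.mpr h3 (hX q h1)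

variable [Module.Finite R S]

/-- Restriction of scalars `G(S) → G(R)`, `[X] ↦ [X]`. -/
noncomputable def gRestrict : G S →+ G R :=
  QuotientAddGroup.lift _ (FreeAbelianGroup.lift fun X => gClass R (restrictObj R S X)) (by
    rw [AddSubgroup.closure_le]
    rintro _ ⟨M₁, M₂, M₃, f, g, hf, hfg, hg, rfl⟩
    simp only [SetLike.mem_coe, AddMonoidHom.mem_ker, map_sub, FreeAbelianGroup.lift_apply_of]
    unfold gClass
    rw [← map_sub, ← map_sub]
    refine (QuotientAddGroup.eq_zero_iff _).mpr (AddSubgroup.subset_closure ?_)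
    exact ⟨restrictObj R S M₁, restrictObj R S M₂, restrictObj R S M₃,
      ⟨⟨f, f.map_add⟩, fun r x => f.map_smul (algebraMap R S r) x⟩,
      ⟨⟨g, g.map_add⟩, fun r x => g.map_smul (algebraMap R S r) x⟩, hf, hfg, hg, rfl⟩)

/-- Restriction of scalars `H(S) → H(R)`, `[X] ↦ [X]`. -/
noncomputable def hRestrict : H S →+ H R :=
  QuotientAddGroup.map _ (pseudoZeroSubgroup R) (gRestrict R S) (by
    rw [pseudoZeroSubgroup, AddSubgroup.closure_le]
    rintro _ ⟨M, hM, rfl⟩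
    refine AddSubgroup.subset_closure ⟨restrictObj R S M, hM.restrict R S M, ?_⟩
    simp [gRestrict, gClass])

/-- The natural `ℝ`-linear map `H(S)_ℝ → H(R)_ℝ`, `[X] ↦ [X]`. -/
noncomputable def realRestrict : HReal S →ₗ[ℝ] HReal R :=
  (hRestrict R S).toIntLinearMap.baseChange ℝ

/-- The image `V` of the cone `C(S)` under the natural map `H(S)_ℝ → H(R)_ℝ`. -/
noncomputable def imageCone : PointedCone ℝ (HReal R) :=
  (cmCone S).map (realRestrict R S)

end Extension

/-! ### The `R`-dual of an `S`-module -/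

section Dual

/-- The `R`-dual `N* = Hom_R(N, R)` of an `S`-module `N`, with its `S`-module structure
`(s • φ) x = φ (s • x)`. -/
def RDual (R _S N : Type u) [CommRing R] [AddCommGroup N] [Module R N] : Type u := N →ₗ[R] R

variable (R S : Type u) [CommRing R] [CommRing S] [Algebra R S]
variable (N : Type u) [AddCommGroup N] [Module R N] [Module S N] [IsScalarTower R S N]

instance : AddCommGroup (RDual R S N) := inferInstanceAs (AddCommGroup (N →ₗ[R] R))

instance : Module R (RDual R S N) := inferInstanceAs (Module R (N →ₗ[R] R))

instance : Module S (RDual R S N) where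
  smul s φ := LinearMap.comp (show N →ₗ[R] R from φ) (Algebra.lsmul R R N s)
  one_smul φ := LinearMap.ext fun x => congrArg (show N →ₗ[R] R from φ) (one_smul S x)
  mul_smul s t φ := LinearMap.ext fun x => congrArg (show N →ₗ[R] R from φ)
    (show (s * t) • x = t • s • x by rw [mul_comm, mul_smul])
  smul_zero _ := rfl
  smul_add _ _ _ := rfl
  add_smul s t φ := LinearMap.ext fun x =>
    (congrArg (show N →ₗ[R] R from φ) (add_smul s t x)).trans
      ((show N →ₗ[R] R from φ).map_add _ _)
  zero_smul φ := LinearMap.ext fun x =>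
    (congrArg (show N →ₗ[R] R from φ) (zero_smul S x)).trans
      ((show N →ₗ[R] R from φ).map_zero)

theorem RDual.smul_apply (s : S) (φ : RDual R S N) (x : N) :
    (show N →ₗ[R] R from s • φ) x = (show N →ₗ[R] R from φ) (s • x) := rfl

instance : IsScalarTower R S (RDual R S N) :=
  IsScalarTower.of_algebraMap_smul fun r φ => LinearMap.ext fun x =>
    (congrArg (show N →ₗ[R] R from φ) (algebraMap_smul S r x)).trans
      ((show N →ₗ[R] R from φ).map_smul r x)

instance [IsNoetherianRing R] [Module.Finite R S] [Module.Finite S N] :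
    Module.Finite S (RDual R S N) := by
  have : Module.Finite R N := Module.Finite.trans S N
  obtain ⟨n, g, hg⟩ := Module.Finite.exists_fin' R N
  have : Module.Finite R (N →ₗ[R] R) :=
    Module.Finite.of_injective (LinearMap.lcomp R R g) (fun φ ψ h => by
      refine LinearMap.ext fun x => ?_
      obtain ⟨y, rfl⟩ := hg x
      exact LinearMap.congr_fun h y)
  have : Module.Finite R (RDual R S N) := inferInstanceAs (Module.Finite R (N →ₗ[R] R))
  exact Module.Finite.of_restrictScalars_finite R S _

end Dual

end GrothendieckCone

/-!
The point is that `[R]` is an order unit of `V`: every `w` satisfies `K[R] + w ∈ V` for some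
`K ≥ 0`. Since `[Ωⁿ M] = bₙ[R] ± [M]` with `bₙ + bₙ₊₁ = βₙ(M)`, it then suffices that the `bₙ` are
not eventually bounded above, and if they were, the Betti numbers would be bounded.

An order unit of `V` is the image under `f` of an order unit of `c(S)`. The latter is found in the
form `[N ⊕ N*]`: any interior point is an order unit, and `[S]` is one because high syzygies are
maximal Cohen–Macaulay, so that `N = S` works in the second case. Finally `[N] + [N*]` is a multiple
of `[R]` in `h(R)`: along a filtration of `N` with quotients `R ⧸ p`, a quotient with `p ≠ 0` adds
`[R ⧸ p]` to `[N]` and removes `[Ext¹(R ⧸ p, R)] = [R ⧸ p]` from `[N*]`.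
-/

namespace GrothendieckCone

open IsLocalRing
open scoped Pointwise

/-! ### Weakly regular sequences -/

section RegularSequences

open RingTheory.Sequence

/-- The ideal `I` contains a weakly `M`-regular sequence of length `n`. For the maximal ideal of a
local ring this says `n ≤ depth M`. -/
def HasRegularSequence {A : Type*} [CommRing A] (I : Ideal A) (n : ℕ) (M : Type*)
    [AddCommGroup M] [Module A M] : Prop :=
  ∃ rs : List A, rs.length = n ∧ (∀ r ∈ rs, r ∈ I) ∧ IsWeaklyRegular M rs

namespace HasRegularSequence

variable {A : Type*} [CommRing A] {I : Ideal A} {n : ℕ}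
variable {M N : Type*} [AddCommGroup M] [Module A M] [AddCommGroup N] [Module A N]

theorem zero : HasRegularSequence I 0 M :=
  ⟨[], rfl, by simp, by simp⟩

theorem succ_iff : HasRegularSequence I (n + 1) M ↔
    ∃ x ∈ I, IsSMulRegular M x ∧ HasRegularSequence I n (QuotSMulTop x M) := by
  constructor
  · rintro ⟨_ | ⟨x, rs⟩, hl, hI, hr⟩
    · simp at hl
    rw [isWeaklyRegular_cons_iff] at hr
    exact ⟨x, hI x (by simp), hr.1, rs, by simpa using hl, fun r h => hI r (by simp [h]), hr.2⟩
  · rintro ⟨x, hx, hr, rs, hl, hI, hw⟩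
    exact ⟨x :: rs, by simp [hl], by simpa [hx] using hI, .cons hr hw⟩

theorem of_equiv (e : M ≃ₗ[A] N) (h : HasRegularSequence I n M) : HasRegularSequence I n N := by
  obtain ⟨rs, hl, hI, hw⟩ := h
  exact ⟨rs, hl, hI, (e.isWeaklyRegular_congr rs).mp hw⟩

theorem mono {m : ℕ} (hmn : m ≤ n) (h : HasRegularSequence I n M) : HasRegularSequence I m M := by
  obtain ⟨rs, hl, hI, hw⟩ := h
  refine ⟨rs.take m, by simp [hl, hmn], fun r hr => hI r (List.mem_of_mem_take hr), ?_⟩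
  rw [← List.take_append_drop m rs, isWeaklyRegular_append_iff] at hw
  exact hw.1

theorem of_flat [Module.Flat A M] (h : HasRegularSequence I n A) : HasRegularSequence I n M := by
  obtain ⟨rs, hl, hI, hw⟩ := h
  exact ⟨rs, hl, hI, ((TensorProduct.rid A M).isWeaklyRegular_congr rs).mp
    (hw.isWeaklyRegular_lTensor (M₂ := M))⟩

theorem of_subsingleton [Subsingleton M] : HasRegularSequence I n M := by
  induction n generalizing M with
  | zero => exact zero
  | succ n ih =>
    exact succ_iff.mpr ⟨0, I.zero_mem, Function.injective_of_subsingleton _, ih⟩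

end HasRegularSequence

section Local

variable {A : Type*} [CommRing A] [IsLocalRing A] {M : Type*} [AddCommGroup M] [Module A M]

theorem le_depth_iff {n : ℕ} :
    (n : ℕ∞) ≤ depth A M ↔ HasRegularSequence (maximalIdeal A) n M := by
  constructor
  · intro h
    rcases n with _ | n
    · exact .zero
    have hlt : (n : ℕ∞) < depth A M := lt_of_lt_of_le (by exact_mod_cast n.lt_succ_self) h
    simp only [depth, lt_iSup_iff] at hlt
    obtain ⟨rs, ⟨hI, hw⟩, hlt⟩ := hlt
    exact .mono (by exact_mod_cast hlt) ⟨rs, rfl, hI, hw⟩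
  · rintro ⟨rs, rfl, hI, hw⟩
    exact le_iSup₂ (f := fun (rs : List A) (_ : (∀ r ∈ rs, r ∈ maximalIdeal A) ∧
      IsWeaklyRegular M rs) => (rs.length : ℕ∞)) rs ⟨hI, hw⟩

theorem hasRegularSequence_one_iff [IsNoetherianRing A] [Module.Finite A M] :
    HasRegularSequence (maximalIdeal A) 1 M ↔ maximalIdeal A ∉ associatedPrimes A M := by
  have hunion := biUnion_associatedPrimes_eq_compl_regular A M
  rw [HasRegularSequence.succ_iff, ← not_iff_not, not_not]
  constructor
  · intro h
    have hsub : (maximalIdeal A : Set A) ⊆ ⋃ P ∈ associatedPrimes A M, (P : Set A) :=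
      hunion ▸ fun x hx hr => h ⟨x, hx, hr, .zero⟩
    obtain ⟨P, hP, hle⟩ := (Ideal.subset_union_prime_finite (associatedPrimes.finite A M)
      (f := id) 0 0 fun _ h _ _ => h.isPrime).1 hsub
    exact (maximalIdeal.isMaximal A).eq_of_le hP.isPrime.ne_top hle ▸ hP
  · rintro h ⟨x, hx, hr, -⟩
    exact (hunion.subset (Set.mem_biUnion h hx)) hr

end Local

section Ext

open CategoryTheory Abelian

variable {A : Type u} [CommRing A] [IsLocalRing A] [IsNoetherianRing A] {n : ℕ}
variable {M N F : Type u} [AddCommGroup M] [Module A M] [Module.Finite A M]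
  [AddCommGroup N] [Module A N] [Module.Finite A N] [AddCommGroup F] [Module A F]
  [Module.Finite A F]

theorem hasRegularSequence_iff_subsingleton_ext :
    HasRegularSequence (maximalIdeal A) n M ↔ ∀ i < n,
      Subsingleton (Ext (ModuleCat.of A (A ⧸ maximalIdeal A)) (ModuleCat.of A M) i) := by
  have hsupp : Module.support A (A ⧸ maximalIdeal A) =
      PrimeSpectrum.zeroLocus (maximalIdeal A) := by
    rw [Module.support_eq_zeroLocus, Ideal.annihilator_quotient]
  rcases subsingleton_or_nontrivial M with hM | hM
  · have hzero : 𝟙 (ModuleCat.of A M) = 0 := (ModuleCat.isZero_of_subsingleton _).eq_of_src _ _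
    refine iff_of_true .of_subsingleton fun i _ => subsingleton_of_forall_eq 0 fun e => ?_
    rw [← e.comp_mk₀_id, hzero, Ext.mk₀_zero, Ext.comp_zero]
  have hne : ⊤ ≠ maximalIdeal A • (⊤ : Submodule A M) :=
    Submodule.top_ne_ideal_smul_of_le_jacobson_annihilator (maximalIdeal_le_jacobson _)
  constructor
  · rintro ⟨rs, rfl, hmem, hw⟩
    exact ModuleCat.subsingleton_ext_of_exists_isRegular (maximalIdeal A)
      (.of A (A ⧸ maximalIdeal A)) hsupp.subset (.of A M) hne.symm.lt_top rs hmem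
      ((IsLocalRing.isRegular_iff_isWeaklyRegular_of_subset_maximalIdeal hmem).mpr hw)
  · intro h
    obtain ⟨rs, hl, hmem, hr⟩ := ModuleCat.exists_isRegular_of_exists_subsingleton_ext
      (maximalIdeal A) n (.of A M) hne.symm.lt_top (.of A (A ⧸ maximalIdeal A)) hsupp h
    exact ⟨rs, hl, hmem, hr.toIsWeaklyRegular⟩

theorem HasRegularSequence.quotSMulTop (h : HasRegularSequence (maximalIdeal A) (n + 1) M)
    {x : A} (hx : IsSMulRegular M x) :
    HasRegularSequence (maximalIdeal A) n (QuotSMulTop x M) := by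
  rw [hasRegularSequence_iff_subsingleton_ext] at h ⊢
  intro i hi
  have hexact := Ext.covariant_sequence_exact₃' (ModuleCat.of A (A ⧸ maximalIdeal A))
    (hx.smulShortComplex_shortExact (M := .of A M)) i (i + 1) rfl
  exact AddCommGrpCat.subsingleton_of_isZero (hexact.isZero_of_both_zeros
    ((AddCommGrpCat.isZero_of_iff_subsingleton.mpr (h i (by lia))).eq_zero_of_src _)
    ((AddCommGrpCat.isZero_of_iff_subsingleton.mpr (h (i + 1) (by lia))).eq_zero_of_tgt _))

theorem HasRegularSequence.kernel {f : M →ₗ[A] F} {g : F →ₗ[A] N} (hf : Function.Injective f)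
    (hfg : Function.Exact f g) (hg : Function.Surjective g)
    (hF : HasRegularSequence (maximalIdeal A) (n + 1) F)
    (hN : HasRegularSequence (maximalIdeal A) n N) :
    HasRegularSequence (maximalIdeal A) (n + 1) M := by
  rw [hasRegularSequence_iff_subsingleton_ext] at hF hN ⊢
  have hS := ModuleCat.shortComplex_shortExact
    (ModuleCat.shortComplexOfCompEqZero f g hfg.linearMap_comp_eq_zero) hfg hf hg
  rintro (_ | i) hi
  · have := hS.mono_f
    have := hF 0 hi
    exact (Ext.postcomp_mk₀_injective_of_mono _ (ModuleCat.ofHom f)).subsingleton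
  have hexact :=
    Ext.covariant_sequence_exact₁' (ModuleCat.of A (A ⧸ maximalIdeal A)) hS i (i + 1) rfl
  exact AddCommGrpCat.subsingleton_of_isZero (hexact.isZero_of_both_zeros
    ((AddCommGrpCat.isZero_of_iff_subsingleton.mpr (hN i (by lia))).eq_zero_of_src _)
    ((AddCommGrpCat.isZero_of_iff_subsingleton.mpr (hF (i + 1) (by lia))).eq_zero_of_tgt _))

end Ext

end RegularSequences

/-! ### Depth at a prime -/

section Localization

variable {S : Type*} [CommRing S] {q : Ideal S} [q.IsPrime]

theorem isSMulRegular_localizedModule_iff {X : Type*} [AddCommGroup X] [Module S X] {x : S} :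
    IsSMulRegular (LocalizedModule q.primeCompl X) x ↔
      ∀ m : X, x • m = 0 → ∃ s ∉ q, s • m = 0 := by
  rw [isSMulRegular_iff_right_eq_zero_of_smul]
  constructor
  · intro h m hm
    have hm' : LocalizedModule.mkLinearMap q.primeCompl X m = 0 :=
      h _ (by rw [← map_smul, hm, map_zero])
    obtain ⟨s, hs, hsm⟩ := LocalizedModule.mem_ker_mkLinearMap_iff.mp hm'
    exact ⟨s, hs, hsm⟩
  · intro h y hy
    obtain ⟨⟨m, s⟩, rfl⟩ :=
      IsLocalizedModule.mk'_surjective q.primeCompl (LocalizedModule.mkLinearMap q.primeCompl X) y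
    rw [Function.uncurry_apply_pair] at hy ⊢
    rw [← IsLocalizedModule.mk'_smul, IsLocalizedModule.mk'_eq_zero'] at hy
    obtain ⟨t, ht⟩ := hy
    obtain ⟨u, hu, hum⟩ := h ((t : S) • m) (by rw [smul_comm]; exact ht)
    exact (IsLocalizedModule.mk'_eq_zero' _ _).mpr ⟨⟨u, hu⟩ * t, by rwa [mul_smul]⟩

/-- The depth of the localization of `X` at the prime `q` is at least `n`. -/
def HasDepthAt (q : Ideal S) [q.IsPrime] (n : ℕ) (X : Type*) [AddCommGroup X] [Module S X] : Prop :=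
  HasRegularSequence (maximalIdeal (Localization.AtPrime q)) n (LocalizedModule q.primeCompl X)

/-- Localization commutes with dividing out multiples of an element. -/
noncomputable def localizedQuotSMulTopEquiv (x : S) (X : Type*) [AddCommGroup X] [Module S X] :
    QuotSMulTop (algebraMap S (Localization.AtPrime q) x) (LocalizedModule q.primeCompl X)
      ≃ₗ[Localization.AtPrime q] LocalizedModule q.primeCompl (QuotSMulTop x X) :=
  QuotSMulTop.congr _ (LocalizedModule.equivTensorProduct q.primeCompl X) ≪≫ₗ
    QuotSMulTop.algebraMapTensorEquivTensorQuotSMulTop x X _ ≪≫ₗ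
    (LocalizedModule.equivTensorProduct q.primeCompl (QuotSMulTop x X)).symm

theorem exists_mem_associated_algebraMap {z : Localization.AtPrime q}
    (hz : z ∈ maximalIdeal (Localization.AtPrime q)) :
    ∃ x ∈ q, Associated (algebraMap S (Localization.AtPrime q) x) z := by
  obtain ⟨x, s, rfl⟩ := IsLocalization.exists_mk'_eq q.primeCompl z
  refine ⟨x, (IsLocalization.AtPrime.mk'_mem_maximal_iff _ q x s).mp hz, .symm ?_⟩
  exact ⟨(IsLocalization.map_units _ s).unit, IsLocalization.mk'_spec _ x s⟩

namespace HasDepthAt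

variable {n : ℕ}

section Successor

variable {X Y : Type*} [AddCommGroup X] [Module S X] [AddCommGroup Y] [Module S Y]

theorem of_equiv (e : X ≃ₗ[S] Y) (h : HasDepthAt q n X) : HasDepthAt q n Y :=
  HasRegularSequence.of_equiv (IsLocalizedModule.mapEquiv q.primeCompl
    (LocalizedModule.mkLinearMap q.primeCompl X) (LocalizedModule.mkLinearMap q.primeCompl Y)
    (Localization.AtPrime q) e) h

theorem succ_iff : HasDepthAt q (n + 1) X ↔
    ∃ x ∈ q, IsSMulRegular (LocalizedModule q.primeCompl X) x ∧
      HasDepthAt q n (QuotSMulTop x X) := by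
  rw [HasDepthAt, HasRegularSequence.succ_iff]
  constructor
  · rintro ⟨z, hz, hr, h⟩
    obtain ⟨x, hx, hxz⟩ := exists_mem_associated_algebraMap hz
    obtain ⟨u, hu⟩ := hxz.symm
    have htop : z • (⊤ : Submodule (Localization.AtPrime q) (LocalizedModule q.primeCompl X)) =
        algebraMap S (Localization.AtPrime q) x • ⊤ := by
      rw [← hu, ← Submodule.ideal_span_singleton_smul, ← Submodule.ideal_span_singleton_smul,
        Ideal.span_singleton_mul_right_unit u.isUnit]
    refine ⟨x, hx, ?_, h.of_equiv
      (Submodule.quotEquivOfEq _ _ htop ≪≫ₗ localizedQuotSMulTopEquiv x X)⟩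
    rw [← isSMulRegular_algebraMap_iff (Localization.AtPrime q), ← hu]
    exact hr.mul (u.isUnit.isSMulRegular _)
  · rintro ⟨x, hx, hr, h⟩
    exact ⟨algebraMap S _ x, (IsLocalization.AtPrime.to_map_mem_maximal_iff _ q x).mpr hx,
      (isSMulRegular_algebraMap_iff _).mpr hr,
      HasRegularSequence.of_equiv (localizedQuotSMulTopEquiv x X).symm h⟩

end Successor

theorem one_iff [IsNoetherianRing S] {X : Type*} [AddCommGroup X] [Module S X]
    [Module.Finite S X] : HasDepthAt q 1 X ↔ q ∉ associatedPrimes S X := by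
  open Module.associatedPrimes in
  rw [HasDepthAt, hasRegularSequence_one_iff,
    ← preimage_comap_associatedPrimes_eq_associatedPrimes_of_isLocalizedModule
      q.primeCompl (Localization.AtPrime q) (LocalizedModule.mkLinearMap q.primeCompl X),
    Set.mem_preimage, ← Ideal.under_def, Localization.AtPrime.under_maximalIdeal]

end HasDepthAt

end Localization

section Noetherian

variable {S : Type u} [CommRing S] [IsNoetherianRing S] {q : Ideal S} [q.IsPrime] {n : ℕ}

theorem HasDepthAt.quotSMulTop {X : Type u} [AddCommGroup X] [Module S X] [Module.Finite S X]
    (h : HasDepthAt q (n + 1) X) {x : S}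
    (hx : IsSMulRegular (LocalizedModule q.primeCompl X) x) : HasDepthAt q n (QuotSMulTop x X) :=
  (HasRegularSequence.quotSMulTop h
    ((isSMulRegular_algebraMap_iff (Localization.AtPrime q)).mpr hx)).of_equiv
      (localizedQuotSMulTopEquiv x X)

theorem HasDepthAt.kernel {M N F : Type u} [AddCommGroup M]
    [AddCommGroup N] [AddCommGroup F] [Module S M] [Module S N] [Module S F] [Module.Finite S M]
    [Module.Finite S N] [Module.Finite S F] {f : M →ₗ[S] F} {g : F →ₗ[S] N}
    (hf : Function.Injective f) (hfg : Function.Exact f g) (hg : Function.Surjective g)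
    (hF : HasDepthAt q (n + 1) F) (hN : HasDepthAt q n N) : HasDepthAt q (n + 1) M :=
  HasRegularSequence.kernel (f := LocalizedModule.map q.primeCompl f)
    (g := LocalizedModule.map q.primeCompl g) (LocalizedModule.map_injective _ f hf)
    (LocalizedModule.map_exact _ f g hfg) (LocalizedModule.map_surjective _ g hg) hF hN

end Noetherian

theorem isMCM_iff {S : Type u} [CommRing S] {X : Type*} [AddCommGroup X]
    [Module S X] : IsMCM S X ↔
      ∀ (q : Ideal S) [q.IsPrime] (n : ℕ), n ≤ q.height → HasDepthAt q n X :=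
  forall₂_congr fun _ _ => ENat.forall_natCast_le_iff_le.symm.trans
    (forall₂_congr fun _ _ => le_depth_iff)

theorem IsCohenMacaulay.isMCM {S : Type u} [CommRing S] (h : IsCohenMacaulay S) {X : Type*}
    [AddCommGroup X] [Module S X] [Module.Flat S X] : IsMCM S X := by
  refine isMCM_iff.mpr fun q _ n hn => HasRegularSequence.of_flat ?_
  rw [← le_depth_iff, h q]
  exact hn

/-! ### Maximal Cohen–Macaulay modules under finite extensions -/

section Extension

section Descent

variable {R S X : Type*} [CommRing R] [CommRing S] [Algebra R S]
  [AddCommGroup X] [Module R X] [Module S X] [IsScalarTower R S X]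

theorem exists_mem_associatedPrimes_comap_eq [IsNoetherianRing R] [IsNoetherianRing S]
    [Algebra.IsIntegral R S] {p : Ideal R} (hp : p ∈ associatedPrimes R X) :
    ∃ q ∈ associatedPrimes S X, q.comap (algebraMap R S) = p := by
  rw [AssociatedPrimes.mem_iff, isAssociatedPrime_iff] at hp
  obtain ⟨hp, y, hy⟩ := hp
  let Y : Submodule S X := Submodule.span S {y}
  have hJ (r : R) : algebraMap R S r ∈ Module.annihilator S Y ↔ r ∈ p := by
    rw [hy, Submodule.mem_colon_singleton, Submodule.mem_bot]
    change _ ∈ (Submodule.span S {y}).annihilator ↔ _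
    rw [Submodule.mem_annihilator_span_singleton, algebraMap_smul]
  obtain ⟨q, hq, hqp, hqc⟩ := Ideal.exists_ideal_over_prime_of_isIntegral p
    (Module.annihilator S Y) fun r => (hJ r).mp
  obtain ⟨q', hq', hle⟩ := Ideal.exists_minimalPrimes_le hq
  exact ⟨q', associatedPrimes.subset_of_injective Y.subtype_injective
    (Module.associatedPrimes.minimalPrimes_annihilator_subset_associatedPrimes S Y hq'),
    le_antisymm (hqc ▸ Ideal.comap_mono hle) fun r hr => hq'.1.2 ((hJ r).mpr hr)⟩

/-- Dividing an `S`-module by multiples of an element of `R` over either ring. -/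
noncomputable def quotSMulTopRestrictEquiv (x : R) (X : Type*) [AddCommGroup X] [Module R X]
    [Module S X] [IsScalarTower R S X] :
    QuotSMulTop (algebraMap R S x) X ≃ₗ[R] QuotSMulTop x X :=
  (Submodule.Quotient.restrictScalarsEquiv R (algebraMap R S x • (⊤ : Submodule S X))).symm ≪≫ₗ
    Submodule.quotEquivOfEq _ _ (by
      ext y
      simp [Submodule.mem_smul_pointwise_iff_exists])

variable {p : Ideal R} [p.IsPrime] {q : Ideal S} [q.IsPrime]

theorem isSMulRegular_localizedModule_of_comap_eq (hq : q.comap (algebraMap R S) = p) {x : R}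
    (h : IsSMulRegular (LocalizedModule p.primeCompl X) x) :
    IsSMulRegular (LocalizedModule q.primeCompl X) (algebraMap R S x) := by
  rw [isSMulRegular_localizedModule_iff] at h ⊢
  intro m hm
  obtain ⟨s, hs, hsm⟩ := h m (by rwa [algebraMap_smul] at hm)
  exact ⟨algebraMap R S s, fun hsq => hs (hq ▸ hsq), by rwa [algebraMap_smul]⟩

theorem HasDepthAt.of_restrictScalars {n : ℕ}
    (hq : q.comap (algebraMap R S) = p) (h : HasDepthAt p n X) : HasDepthAt q n X := by
  induction n generalizing X with
  | zero => exact HasRegularSequence.zero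
  | succ n ih =>
    obtain ⟨x, hx, hr, h⟩ := HasDepthAt.succ_iff.mp h
    exact HasDepthAt.succ_iff.mpr ⟨algebraMap R S x, hq.ge hx,
      isSMulRegular_localizedModule_of_comap_eq hq hr,
      ih (h.of_equiv (quotSMulTopRestrictEquiv x X).symm)⟩

end Descent

variable {R S X : Type u} [CommRing R] [CommRing S] [Algebra R S]
  [AddCommGroup X] [Module R X] [Module S X] [IsScalarTower R S X]
  [Module.Finite R S]

theorem HasDepthAt.restrictScalars [IsNoetherianRing R] [Module.Finite S X]
    {n : ℕ} {p : Ideal R} [p.IsPrime]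
    (h : ∀ (q : Ideal S) [q.IsPrime], q.comap (algebraMap R S) = p → HasDepthAt q n X) :
    HasDepthAt p n X := by
  have : IsNoetherianRing S := .of_finite R S
  induction n generalizing X with
  | zero => exact HasRegularSequence.zero
  | succ n ih =>
    have : Module.Finite R X := Module.Finite.trans S X
    have hp : HasDepthAt p 1 X := by
      rw [HasDepthAt.one_iff]
      intro hp
      obtain ⟨q, hq, hqc⟩ := exists_mem_associatedPrimes_comap_eq (S := S) hp
      have := hq.isPrime
      exact HasDepthAt.one_iff.mp ((h q hqc).mono (by lia)) hq
    obtain ⟨x, hx, hr, -⟩ := HasDepthAt.succ_iff.mp hp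
    refine HasDepthAt.succ_iff.mpr ⟨x, hx, hr, .of_equiv (quotSMulTopRestrictEquiv (S := S) x X) ?_⟩
    exact ih fun q _ hq => (h q hq).quotSMulTop (isSMulRegular_localizedModule_of_comap_eq hq hr)

theorem IsMCM.of_restrictScalars (h : IsMCM R X) : IsMCM S X :=
  isMCM_iff.mpr fun q _ n hn =>
    (isMCM_iff.mp h _ n (hn.trans (height_le_height_comap R S q))).of_restrictScalars rfl

theorem height_eq_height_comap [IsNoetherianRing R] [IsDomain S] [FaithfulSMul R S]
    [IsIntegrallyClosed R] (q : Ideal S) [q.IsPrime] :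
    q.height = (q.comap (algebraMap R S)).height := by
  have : IsNoetherianRing S := .of_finite R S
  refine le_antisymm (height_le_height_comap R S q) ?_
  have : q.LiesOver (q.comap (algebraMap R S)) := ⟨rfl⟩
  rw [Ideal.height_eq_height_add_of_liesOver_of_hasGoingDown (q.comap (algebraMap R S)) q]
  exact le_self_add

theorem IsMCM.restrictScalars [IsNoetherianRing R] [Module.Finite S X] [IsDomain S]
    [FaithfulSMul R S] [IsIntegrallyClosed R] (h : IsMCM S X) : IsMCM R X :=
  isMCM_iff.mpr fun p _ n hn => HasDepthAt.restrictScalars fun q _ hq =>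
    isMCM_iff.mp h q n (by rwa [height_eq_height_comap (R := R) q, hq])

end Extension

/-! ### Classes of modules -/

section Classes

variable (R : Type u) [CommRing R]

/-- The class in `H(R)` of an unbundled finitely generated module. -/
noncomputable def cls (M : Type u) [AddCommGroup M] [Module R M] [Module.Finite R M] : H R :=
  hClass R (FGModuleCat.of R M)

/-- The canonical map `H(R) → H(R)_ℝ`, transporting identities between integral classes to
`H(R)_ℝ`. -/
noncomputable def toReal : H R →+ HReal R where
  toFun x := TensorProduct.tmul ℤ 1 x
  map_zero' := TensorProduct.tmul_zero _ _
  map_add' := TensorProduct.tmul_add _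

variable {R}
variable {M N F : Type u} [AddCommGroup M] [Module R M] [Module.Finite R M]
  [AddCommGroup N] [Module R N] [Module.Finite R N] [AddCommGroup F] [Module R F]
  [Module.Finite R F]

theorem toReal_cls : toReal R (cls R M) = realClass R M := rfl

theorem cls_eq_add {f : M →ₗ[R] F} {g : F →ₗ[R] N} (hf : Function.Injective f)
    (hfg : Function.Exact f g) (hg : Function.Surjective g) :
    cls R F = cls R M + cls R N := by
  have h : gClass R (FGModuleCat.of R F) =
      gClass R (FGModuleCat.of R M) + gClass R (FGModuleCat.of R N) := by
    rw [← sub_eq_iff_eq_add', gClass, gClass, gClass, ← map_sub, ← sub_eq_zero, ← map_sub]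
    exact (QuotientAddGroup.eq_zero_iff _).mpr (AddSubgroup.subset_closure
      ⟨FGModuleCat.of R M, FGModuleCat.of R F, FGModuleCat.of R N, f, g, hf, hfg, hg, rfl⟩)
  simp only [cls, hClass, h, map_add]

theorem cls_eq_zero_of_isPseudoZero (h : IsPseudoZero R M) : cls R M = 0 :=
  (QuotientAddGroup.eq_zero_iff _).mpr (AddSubgroup.subset_closure ⟨FGModuleCat.of R M, h, rfl⟩)

theorem cls_eq_zero_of_subsingleton [Subsingleton M] : cls R M = 0 :=
  cls_eq_zero_of_isPseudoZero fun _ _ _ =>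
    LocalizedModule.subsingleton_iff.mpr fun _ => ⟨1, one_mem _, Subsingleton.elim _ _⟩

theorem cls_congr (e : M ≃ₗ[R] N) : cls R M = cls R N := by
  rw [cls_eq_add (N := PUnit) (g := 0) (f := e.toLinearMap) e.injective
    ((e.toLinearMap.exact_zero_iff_surjective _).mpr e.surjective)
    (Function.surjective_to_subsingleton _), cls_eq_zero_of_subsingleton (M := PUnit), add_zero]

theorem cls_eq_of_isPseudoZero_coker {f : M →ₗ[R] N} (hf : Function.Injective f)
    (h : IsPseudoZero R (N ⧸ LinearMap.range f)) : cls R M = cls R N := by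
  rw [cls_eq_add hf (LinearMap.exact_map_mkQ_range f) (Submodule.mkQ_surjective _),
    cls_eq_zero_of_isPseudoZero h, add_zero]

theorem cls_prod : cls R (M × N) = cls R M + cls R N :=
  cls_eq_add LinearMap.inl_injective Function.Exact.inl_snd LinearMap.snd_surjective

theorem cls_pi (n : ℕ) : cls R (Fin n → M) = n • cls R M := by
  induction n with
  | zero => rw [cls_eq_zero_of_subsingleton, zero_nsmul]
  | succ n ih =>
    rw [← cls_congr (Fin.consLinearEquiv R fun _ : Fin (n + 1) => M), cls_prod, ih, add_smul,
      one_smul, add_comm]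

theorem realClass_congr (e : M ≃ₗ[R] N) : realClass R M = realClass R N := by
  rw [← toReal_cls, cls_congr e, toReal_cls]

theorem realClass_prod : realClass R (M × N) = realClass R M + realClass R N := by
  rw [← toReal_cls, cls_prod, map_add, toReal_cls, toReal_cls]

theorem realClass_pi (n : ℕ) : realClass R (Fin n → M) = n • realClass R M := by
  rw [← toReal_cls, cls_pi, map_nsmul, toReal_cls]

theorem realClass_eq_add {f : M →ₗ[R] F} {g : F →ₗ[R] N} (hf : Function.Injective f)
    (hfg : Function.Exact f g) (hg : Function.Surjective g) :
    realClass R F = realClass R M + realClass R N := by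
  rw [← toReal_cls, cls_eq_add hf hfg hg, map_add, toReal_cls, toReal_cls]

theorem realClass_eq_zero_of_subsingleton [Subsingleton M] : realClass R M = 0 := by
  rw [← toReal_cls, cls_eq_zero_of_subsingleton, map_zero]

theorem eq_top_of_forall_realClass_mem {W : Submodule ℝ (HReal R)}
    (h : ∀ X : FGModuleCat.{u} R, realClass R X ∈ W) : W = ⊤ := by
  have hW (x : H R) : toReal R x ∈ W := by
    obtain ⟨x, rfl⟩ := QuotientAddGroup.mk'_surjective _ x
    obtain ⟨x, rfl⟩ := QuotientAddGroup.mk'_surjective _ x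
    induction x using FreeAbelianGroup.induction_on with
    | zero => simp only [map_zero, zero_mem]
    | of X => exact h X
    | neg X hX => simpa only [map_neg] using W.neg_mem hX
    | add x y hx hy => simpa only [map_add] using W.add_mem hx hy
  refine eq_top_iff.mpr fun w _ => ?_
  induction w using TensorProduct.induction_on with
  | zero => exact W.zero_mem
  | add x y hx hy => exact W.add_mem (hx trivial) (hy trivial)
  | tmul r x =>
    have hx : TensorProduct.tmul ℤ r x = r • toReal R x := by
      change _ = r • TensorProduct.tmul ℤ (1 : ℝ) x
      rw [TensorProduct.smul_tmul', smul_eq_mul, mul_one]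
    exact hx ▸ W.smul_mem r (hW x)

theorem realClass_mem_of_annihilator_le [IsNoetherianRing R] {W : Submodule ℝ (HReal R)}
    {I : Ideal R} (hI : ∀ (p : Ideal R) [p.IsPrime], I ≤ p → realClass R (R ⧸ p) ∈ W)
    {M : Type u} [AddCommGroup M] [Module R M] [hM : Module.Finite R M]
    (hIM : I ≤ Module.annihilator R M) : realClass R M ∈ W := by
  induction hM using IsNoetherianRing.induction_on_isQuotientEquivQuotientPrime R with
  | subsingleton N => exact realClass_eq_zero_of_subsingleton (R := R) (M := N) ▸ W.zero_mem
  | quotient N p e =>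
    have := p.2
    rw [realClass_congr e]
    exact hI p.1 (by rwa [e.annihilator_eq, Ideal.annihilator_quotient] at hIM)
  | exact N₁ N₂ N₃ f g hf hg hfg h₁ h₃ =>
    rw [realClass_eq_add hf hfg hg]
    exact W.add_mem (h₁ (hIM.trans (f.annihilator_le_of_injective hf)))
      (h₃ (hIM.trans (g.annihilator_le_of_surjective hg)))

end Classes

section Restriction

theorem realRestrict_realClass (R S : Type u) [CommRing R] [CommRing S] [Algebra R S]
    [Module.Finite R S] (X : Type u) [AddCommGroup X] [Module R X] [Module S X]
    [IsScalarTower R S X] [Module.Finite S X] [Module.Finite R X] :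
    realRestrict R S (realClass S X) = realClass R X := by
  have h : hRestrict R S (hClass S (FGModuleCat.of S X)) =
      cls R (restrictObj R S (FGModuleCat.of S X)) := by
    simp [hRestrict, hClass, gRestrict, gClass, cls]
  have e : restrictObj R S (FGModuleCat.of S X) ≃ₗ[R] X :=
    { AddEquiv.refl X with map_smul' := fun r x => algebraMap_smul S r (show X from x) }
  rw [realRestrict, realClass, LinearMap.baseChange_tmul, ← toReal_cls, ← cls_congr e, ← h]
  rfl

theorem exists_injective_forall_smul_mem_range (A M : Type*) [CommRing A] [IsDomain A]
    [AddCommGroup M] [Module A M] [Module.Finite A M] :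
    ∃ f : (Fin (Module.finrank A M) → A) →ₗ[A] M, Function.Injective f ∧
      ∃ a : A, a ≠ 0 ∧ ∀ m, a • m ∈ LinearMap.range f := by
  obtain ⟨v, hv⟩ := exists_linearIndependent_of_le_finrank (R := A) (M := M) le_rfl
  have htorsion : Module.IsTorsion A (M ⧸ Submodule.span A (Set.range v)) := by
    rw [← Module.finrank_eq_zero_iff_isTorsion, Submodule.finrank_quotient,
      finrank_span_eq_card hv, Fintype.card_fin, Nat.sub_self]
  obtain ⟨a, ha, ha0⟩ := Submodule.annihilator_top_inter_nonZeroDivisors htorsion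
  refine ⟨Fintype.linearCombination A v,
    linearIndependent_iff_injective_fintypeLinearCombination.mp hv, a,
    nonZeroDivisors.ne_zero ha0, fun m => ?_⟩
  rw [Fintype.range_linearCombination, ← Submodule.Quotient.mk_eq_zero]
  exact Submodule.mem_annihilator.mp ha (Submodule.Quotient.mk m) trivial

theorem exists_realClass_eq_finrank_smul_add {R M : Type u} [CommRing R] (p : Ideal R) [p.IsPrime]
    [AddCommGroup M] [Module R M] [Module (R ⧸ p) M] [IsScalarTower R (R ⧸ p) M]
    [Module.Finite R M] :
    ∃ N : FGModuleCat.{u} R, p < Module.annihilator R N ∧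
      realClass R M = Module.finrank (R ⧸ p) M • realClass R (R ⧸ p) + realClass R N := by
  have : Module.Finite (R ⧸ p) M := .of_restrictScalars_finite R (R ⧸ p) M
  obtain ⟨f, hf, a, ha0, ha⟩ := exists_injective_forall_smul_mem_range (R ⧸ p) M
  obtain ⟨s, rfl⟩ := Ideal.Quotient.mk_surjective a
  have hsmul (r : R) (m : M) : Ideal.Quotient.mk p r • m = r • m := algebraMap_smul (R ⧸ p) r m
  let g : (Fin (Module.finrank (R ⧸ p) M) → R ⧸ p) →ₗ[R] M := f.restrictScalars R
  have hmem (r : R) : r ∈ Module.annihilator R (M ⧸ LinearMap.range g) ↔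
      ∀ m, r • m ∈ LinearMap.range g := by
    simp only [Module.mem_annihilator, (Submodule.mkQ_surjective _).forall, Submodule.mkQ_apply,
      ← Submodule.Quotient.mk_smul, Submodule.Quotient.mk_eq_zero]
  refine ⟨FGModuleCat.of R (M ⧸ LinearMap.range g), SetLike.lt_iff_le_and_exists.mpr
    ⟨fun r hr => (hmem r).mpr fun m => ?_, s, (hmem s).mpr fun m => ?_, fun hs => ?_⟩, ?_⟩
  · rw [← hsmul, Ideal.Quotient.eq_zero_iff_mem.mpr hr, zero_smul]
    exact zero_mem _
  · exact hsmul s m ▸ ha m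
  · exact ha0 (Ideal.Quotient.eq_zero_iff_mem.mpr hs)
  · rw [← realClass_pi]
    exact realClass_eq_add (f := g) hf (LinearMap.exact_map_mkQ_range g)
      (Submodule.mkQ_surjective _)

theorem realRestrict_surjective (R S : Type u) [CommRing R] [CommRing S] [Algebra R S]
    [IsNoetherianRing R] [FaithfulSMul R S] [Module.Finite R S] :
    Function.Surjective (realRestrict R S) := by
  let W := LinearMap.range (realRestrict R S)
  suffices hprime : ∀ p : Ideal R, p.IsPrime → realClass R (R ⧸ p) ∈ W from
    LinearMap.range_eq_top.mp (eq_top_of_forall_realClass_mem fun X =>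
      realClass_mem_of_annihilator_le (fun p hp _ => hprime p hp) bot_le)
  intro p
  induction p using WellFoundedGT.induction with
  | ind p ih =>
    intro hp
    obtain ⟨q, hq, hqp⟩ := (inferInstance : Nonempty (p.primesOver S))
    obtain ⟨N, hN, hclass⟩ := exists_realClass_eq_finrank_smul_add p (M := S ⧸ q)
    have hrank : (Module.finrank (R ⧸ p) (S ⧸ q) : ℝ) ≠ 0 :=
      Nat.cast_ne_zero.mpr Module.finrank_pos.ne'
    have hSq : realClass R (S ⧸ q) ∈ W := ⟨realClass S (S ⧸ q), realRestrict_realClass R S _⟩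
    have hNW : realClass R N ∈ W :=
      realClass_mem_of_annihilator_le (fun p' hp' hle => ih p' (hN.trans_le hle) hp') le_rfl
    rw [hclass, W.add_mem_iff_left hNW, ← Nat.cast_smul_eq_nsmul ℝ] at hSq
    exact (W.smul_mem_iff hrank).mp hSq

end Restriction

/-! ### Primes of height one -/

section HeightOne

variable {R : Type u} [CommRing R]

theorem eq_of_le_of_ne_bot_of_height_le_one [IsDomain R] [IsNoetherianRing R] {p p' : Ideal R}
    [p.IsPrime] (hle : p ≤ p') (hp : p ≠ ⊥) (hp' : p'.height ≤ 1) : p = p' := by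
  have := Ideal.finiteHeight_of_isNoetherianRing p
  have hpos : p.height ≠ 0 := fun h => hp (Ideal.height_eq_zero_iff_eq_bot.mp h)
  exact Ideal.eq_of_le_of_height_le _ hle (hp'.trans (Order.one_le_iff_ne_zero.mpr hpos))

theorem isPseudoZero_of_le_annihilator [IsDomain R] [IsNoetherianRing R] {p : Ideal R} [p.IsPrime]
    (hp : p ≠ ⊥) {M : Type*} [AddCommGroup M] [Module R M] (hpM : p ≤ Module.annihilator R M)
    (h : p.height ≤ 1 → Subsingleton (LocalizedModule p.primeCompl M)) : IsPseudoZero R M := by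
  intro p' _ hp'
  by_cases hle : p ≤ p'
  · obtain rfl := eq_of_le_of_ne_bot_of_height_le_one hle hp hp'
    exact h hp'
  · obtain ⟨s, hs, hs'⟩ := SetLike.not_le_iff_exists.mp hle
    exact LocalizedModule.subsingleton_iff.mpr fun m =>
      ⟨s, hs', Module.mem_annihilator.mp (hpM hs) m⟩

theorem isPrincipalIdealRing_localization [IsDomain R] [IsNoetherianRing R]
    [IsIntegrallyClosed R] {p : Ideal R} [p.IsPrime] (hp : p.height = 1) :
    IsPrincipalIdealRing (Localization.AtPrime p) := by
  refine ((tfae_of_isNoetherianRing_of_isLocalRing_of_isDomain (Localization.AtPrime p)).out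
    0 3 :).mpr ⟨isIntegrallyClosed_of_isLocalization _ p.primeCompl
      p.primeCompl_le_nonZeroDivisors, fun P hP _ => ?_⟩
  have hmap : (P.under R).map (algebraMap R (Localization.AtPrime p)) = P :=
    IsLocalization.map_under p.primeCompl (Localization.AtPrime p) P
  have hle : P.under R ≤ p :=
    (Ideal.comap_mono (le_maximalIdeal_of_isPrime P)).trans_eq
      Localization.AtPrime.under_maximalIdeal
  have hbot : P.under R ≠ ⊥ := fun h => hP (by rw [← hmap, h, Ideal.map_bot])
  rw [← hmap, eq_of_le_of_ne_bot_of_height_le_one hle hbot hp.le]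
  exact Localization.AtPrime.map_eq_maximalIdeal

variable (R) in
/-- A module `M` is torsion-free in codimension one if `M_p` is torsion-free for all primes `p` of
height one. Over a normal domain this is the same as being locally free in codimension one, but,
unlike the latter, it clearly passes to submodules. -/
def IsTorsionFreeInCodimOne (M : Type*) [AddCommGroup M] [Module R M] : Prop :=
  ∀ (p : Ideal R) [p.IsPrime], p.height = 1 →
    Module.IsTorsionFree (Localization.AtPrime p) (LocalizedModule p.primeCompl M)

variable {M N : Type*} [AddCommGroup M] [Module R M] [AddCommGroup N] [Module R N]

theorem IsTorsionFreeInCodimOne.of_injective (h : IsTorsionFreeInCodimOne R N) {f : M →ₗ[R] N}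
    (hf : Function.Injective f) : IsTorsionFreeInCodimOne R M := fun p _ hp =>
  have := h p hp
  (LocalizedModule.map_injective p.primeCompl f hf).moduleIsTorsionFree _ (map_smul _)

theorem IsLocallyFreeInCodimOne.isTorsionFreeInCodimOne (h : IsLocallyFreeInCodimOne R M) :
    IsTorsionFreeInCodimOne R M := fun p _ hp =>
  have := h p hp
  inferInstance

variable [IsDomain R]

theorem isTorsionFreeInCodimOne [Module.IsTorsionFree R M] : IsTorsionFreeInCodimOne R M :=
  fun _ _ _ => inferInstance

theorem IsTorsionFreeInCodimOne.exists_smul_eq_zero (h : IsTorsionFreeInCodimOne R M) {p : Ideal R}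
    [p.IsPrime] (hp : p.height = 1) {x : R} (hx : x ≠ 0) {m : M} (hm : x • m = 0) :
    ∃ s ∉ p, s • m = 0 := by
  have := h p hp
  have : Module.IsTorsionFree R (LocalizedModule p.primeCompl M) :=
    .trans_faithfulSMul R (Localization.AtPrime p) _
  have hmx : x • LocalizedModule.mkLinearMap p.primeCompl M m = 0 := by
    rw [← map_smul, hm, map_zero]
  exact LocalizedModule.mem_ker_mkLinearMap_iff.mp ((smul_eq_zero.mp hmx).resolve_left hx)

theorem IsTorsionFreeInCodimOne.isLocallyFreeInCodimOne [IsNoetherianRing R]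
    [IsIntegrallyClosed R] [Module.Finite R M] (h : IsTorsionFreeInCodimOne R M) :
    IsLocallyFreeInCodimOne R M := fun p _ hp =>
  have := isPrincipalIdealRing_localization hp
  have := h p hp
  inferInstance

theorem exists_mem_maximalIdeal_eq_span [IsNoetherianRing R] [IsIntegrallyClosed R]
    {p : Ideal R} [p.IsPrime] (hp : p.height = 1) :
    ∃ x ∈ p, x ≠ 0 ∧ maximalIdeal (Localization.AtPrime p) =
      Ideal.span {algebraMap R (Localization.AtPrime p) x} := by
  have := isPrincipalIdealRing_localization hp
  obtain ⟨z, hz⟩ := IsPrincipalIdealRing.principal (maximalIdeal (Localization.AtPrime p))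
  obtain ⟨x, s, rfl⟩ := IsLocalization.exists_mk'_eq p.primeCompl z
  have hspan : maximalIdeal (Localization.AtPrime p) =
      Ideal.span {algebraMap R (Localization.AtPrime p) x} := by
    rw [hz, ← IsLocalization.mk'_spec (Localization.AtPrime p) x s,
      Ideal.span_singleton_mul_right_unit (IsLocalization.map_units _ s)]
  refine ⟨x, ?_, ?_, hspan⟩
  · rw [← IsLocalization.AtPrime.to_map_mem_maximal_iff (Localization.AtPrime p) p x, hspan]
    exact Ideal.mem_span_singleton_self _
  · rintro rfl
    have hbot : p = ⊥ := by
      rw [← Localization.AtPrime.under_maximalIdeal (I := p), hspan, map_zero,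
        Ideal.span_singleton_zero, Ideal.under_bot]
    rw [hbot, Ideal.height_bot] at hp
    exact zero_ne_one hp

end HeightOne

section LinearForms

variable {R M : Type*} [CommRing R] [AddCommGroup M] [Module R M]

theorem exists_coord_notMem_of_notMem_smul_top {ι : Type*} (b : Module.Basis ι R M) {I : Ideal R}
    {m : M} (hm : m ∉ I • (⊤ : Submodule R M)) : ∃ i, b.coord i m ∉ I := by
  contrapose! hm
  rw [← b.linearCombination_repr m, Finsupp.linearCombination_apply]
  exact Submodule.sum_mem _ fun i _ => Submodule.smul_mem_smul (hm i) trivial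

theorem exists_dual_notMem_of_free_localizedModule [Module.FinitePresentation R M] {p : Ideal R}
    [p.IsPrime] [Module.Free (Localization.AtPrime p) (LocalizedModule p.primeCompl M)] {a : M}
    (ha : LocalizedModule.mkLinearMap p.primeCompl M a ∉ maximalIdeal (Localization.AtPrime p) •
      (⊤ : Submodule (Localization.AtPrime p) (LocalizedModule p.primeCompl M))) :
    ∃ φ : M →ₗ[R] R, φ a ∉ p := by
  let b := Module.Free.chooseBasis (Localization.AtPrime p) (LocalizedModule p.primeCompl M)
  obtain ⟨i, hi⟩ := exists_coord_notMem_of_notMem_smul_top b ha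
  obtain ⟨φ, s, hφ⟩ := Module.FinitePresentation.exists_lift_of_isLocalizedModule p.primeCompl
    (Algebra.linearMap R (Localization.AtPrime p))
    ((b.coord i).restrictScalars R ∘ₗ LocalizedModule.mkLinearMap p.primeCompl M)
  have hφa : algebraMap R (Localization.AtPrime p) (φ a) =
      algebraMap R (Localization.AtPrime p) s *
        b.coord i (LocalizedModule.mkLinearMap p.primeCompl M a) :=
    (LinearMap.congr_fun hφ a).trans (Algebra.smul_def (s : R) _)
  refine ⟨φ, fun hmem => ?_⟩
  rw [← IsLocalization.AtPrime.to_map_mem_maximal_iff (Localization.AtPrime p) p, hφa] at hmem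
  exact ((maximalIdeal.isMaximal _).isPrime.mem_or_mem hmem).elim (fun hs =>
    s.2 ((IsLocalization.AtPrime.to_map_mem_maximal_iff (Localization.AtPrime p) p _).mp hs)) hi

end LinearForms

/-! ### Classes of dual modules -/

section Dual

variable {R : Type u} [CommRing R] {A B : Type u} [AddCommGroup A] [Module R A] [AddCommGroup B]
  [Module R B] {ι : A →ₗ[R] B}

theorem exists_comp_eq_of_forall_dvd [IsDomain R] (hι : Function.Injective ι) {x : R} (hx : x ≠ 0)
    (hxB : ∀ b, x • b ∈ LinearMap.range ι) {ψ : A →ₗ[R] R}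
    (h : ∀ a b, ι a = x • b → x ∣ ψ a) : ∃ φ : B →ₗ[R] R, φ ∘ₗ ι = ψ := by
  choose e he using hxB
  choose d hd using fun b => h _ _ (he b)
  refine ⟨⟨⟨d, fun b b' => mul_left_cancel₀ hx ?_⟩, fun r b => mul_left_cancel₀ hx ?_⟩,
    LinearMap.ext fun a => mul_left_cancel₀ hx ?_⟩
  · have hadd : e (b + b') = e b + e b' := hι (by simp only [map_add, he, smul_add])
    rw [← hd, hadd, map_add, hd, hd, mul_add]
  · have hsmul : e (r • b) = r • e b := hι (by rw [he, map_smul, he, smul_comm])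
    rw [RingHom.id_apply, ← hd, hsmul, map_smul, hd, smul_eq_mul, smul_eq_mul, mul_left_comm]
  · have hsmul : e (ι a) = x • a := hι (by rw [he, map_smul])
    exact (hd _).symm.trans (by rw [hsmul, map_smul, smul_eq_mul])

theorem cls_add_cls_dual_of_exact [IsNoetherianRing R] [Module.Finite R A] [Module.Finite R B]
    (hι : Function.Injective ι) {π : B →ₗ[R] R} (hιπ : Function.Exact ι π)
    (hπ : Function.Surjective π) :
    cls R B + cls R (B →ₗ[R] R) = cls R A + cls R (A →ₗ[R] R) + 2 • cls R R := by
  obtain ⟨s, hs⟩ := Module.projective_lifting_property π LinearMap.id hπ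
  let e : B ≃ₗ[R] A × R := (hιπ.splitSurjectiveEquiv hι ⟨s, hs⟩).1
  let e' : (B →ₗ[R] R) ≃ₗ[R] (A →ₗ[R] R) × R := e.congrLeft R R ≪≫ₗ
    (LinearMap.coprodEquiv R).symm ≪≫ₗ (LinearEquiv.refl R _).prodCongr
      (LinearMap.ringLmapEquivSelf R R R)
  rw [cls_congr e, cls_congr e', cls_prod, cls_prod, two_nsmul, add_add_add_comm]

variable {p : Ideal R} {π : B →ₗ[R] R ⧸ p}

theorem smul_mem_range_of_exact (hιπ : Function.Exact ι π) {r : R} (hr : r ∈ p) (b : B) :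
    r • b ∈ LinearMap.range ι :=
  (hιπ _).mp (by rw [map_smul, Algebra.smul_def, Ideal.Quotient.algebraMap_eq,
    Ideal.Quotient.eq_zero_iff_mem.mpr hr, zero_mul])

theorem mem_range_lcomp_of_apply_eq_zero [IsDomain R] (hι : Function.Injective ι)
    (hιπ : Function.Exact ι π) {x : R} (hx : x ≠ 0) (hxp : x ∈ p) {a₀ : A} {w : B} (hw : π w = 1)
    (ha₀ : ι a₀ = x • w) {χ : A →ₗ[R] R} (hχ : χ a₀ = 0) :
    χ ∈ LinearMap.range (LinearMap.lcomp R R ι) := by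
  refine exists_comp_eq_of_forall_dvd hι hx (smul_mem_range_of_exact hιπ hxp) fun a b hab => ?_
  obtain ⟨r, hr⟩ := Ideal.Quotient.mk_surjective (π b)
  obtain ⟨a', ha'⟩ : b - r • w ∈ LinearMap.range ι := (hιπ _).mp (by
    rw [map_sub, map_smul, hw, ← hr, Algebra.smul_def, mul_one, Ideal.Quotient.algebraMap_eq,
      sub_self])
  have ha : a = r • a₀ + x • a' := hι (by
    rw [hab, map_add, map_smul, map_smul, ha₀, ha', smul_sub, smul_comm r x, add_sub_cancel])
  exact ⟨χ a', by rw [ha, map_add, map_smul, map_smul, hχ, smul_zero, zero_add, smul_eq_mul]⟩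

theorem lcomp_injective [IsDomain R] (hp : p ≠ ⊥) (hιπ : Function.Exact ι π) :
    Function.Injective (LinearMap.lcomp R R ι) := by
  obtain ⟨x, hxp, hx⟩ := Submodule.exists_mem_ne_zero_of_ne_bot hp
  refine (injective_iff_map_eq_zero _).mpr fun φ hφ => LinearMap.ext fun b => ?_
  obtain ⟨a, ha⟩ := smul_mem_range_of_exact hιπ hxp b
  refine (smul_eq_zero.mp ?_).resolve_left hx
  rw [← map_smul, ← ha]
  exact LinearMap.congr_fun hφ a

theorem le_annihilator_coker_lcomp [IsDomain R] (hι : Function.Injective ι)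
    (hιπ : Function.Exact ι π) :
    p ≤ Module.annihilator R ((A →ₗ[R] R) ⧸ LinearMap.range (LinearMap.lcomp R R ι)) := by
  intro r hr
  refine Module.mem_annihilator.mpr fun q => ?_
  obtain ⟨ψ, rfl⟩ := Submodule.mkQ_surjective _ q
  rw [← map_smul]
  refine (Submodule.Quotient.mk_eq_zero _).mpr ?_
  obtain rfl | hr₀ := eq_or_ne r 0
  · rw [zero_smul]
    exact zero_mem _
  · exact exists_comp_eq_of_forall_dvd hι hr₀ (smul_mem_range_of_exact hιπ hr)
      fun a _ _ => ⟨ψ a, rfl⟩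

theorem exists_smul_eq_smul_of_mem_smul_top [p.IsPrime] {x : R}
    (hxp : maximalIdeal (Localization.AtPrime p) =
      Ideal.span {algebraMap R (Localization.AtPrime p) x}) {a : A}
    (ha : LocalizedModule.mkLinearMap p.primeCompl A a ∈ maximalIdeal (Localization.AtPrime p) •
      (⊤ : Submodule (Localization.AtPrime p) (LocalizedModule p.primeCompl A))) :
    ∃ t ∉ p, ∃ m, t • a = x • m := by
  rw [hxp, Submodule.ideal_span_singleton_smul] at ha
  obtain ⟨y, -, hy⟩ := ha
  induction y using LocalizedModule.induction_on with | h m s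
  have hy' : LocalizedModule.mk (x • m) s = LocalizedModule.mk a 1 := by
    rw [← LocalizedModule.smul'_mk, ← algebraMap_smul (Localization.AtPrime p) x]
    exact hy
  obtain ⟨u, hu⟩ := LocalizedModule.mk_eq.mp hy'
  rw [one_smul, smul_comm, smul_smul] at hu
  exact ⟨u * s, (u * s).2, u • m, hu.symm⟩

variable [IsDomain R] [IsNoetherianRing R] [p.IsPrime]

theorem exists_dual_notMem_of_isTorsionFreeInCodimOne [IsIntegrallyClosed R]
    [Module.Finite R A] (hB : IsTorsionFreeInCodimOne R B) (hι : Function.Injective ι)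
    (hιπ : Function.Exact ι π) (hp : p.height = 1) {x : R} (hx : x ≠ 0)
    (hxp : maximalIdeal (Localization.AtPrime p) =
      Ideal.span {algebraMap R (Localization.AtPrime p) x})
    {a₀ : A} {w : B} (hw : π w = 1) (ha₀ : ι a₀ = x • w) : ∃ φ : A →ₗ[R] R, φ a₀ ∉ p := by
  have := (hB.of_injective hι).isLocallyFreeInCodimOne p hp
  have := Module.finitePresentation_of_finite R A
  refine exists_dual_notMem_of_free_localizedModule fun hmem => ?_
  obtain ⟨t, ht, m, htm⟩ := exists_smul_eq_smul_of_mem_smul_top hxp hmem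
  have hzero : x • (t • w - ι m) = 0 := by
    rw [smul_sub, smul_comm, ← ha₀, ← map_smul, ← map_smul, htm, sub_self]
  obtain ⟨v, hv, hvw⟩ := hB.exists_smul_eq_zero hp hx hzero
  have hvt : Ideal.Quotient.mk p (v * t) = 0 := by
    have := congrArg π hvw
    rwa [map_smul, map_sub, map_smul, hw, hιπ.apply_apply_eq_zero, sub_zero, map_zero, smul_smul,
      Algebra.smul_def, mul_one] at this
  exact (Ideal.IsPrime.mem_or_mem ‹_› (Ideal.Quotient.eq_zero_iff_mem.mp hvt)).elim hv ht

theorem exists_injective_isPseudoZero_coker_of_dual_notMem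
    (hι : Function.Injective ι) (hιπ : Function.Exact ι π) {x : R} (hx : x ≠ 0) (hxp : x ∈ p)
    {a₀ : A} {w : B} (hw : π w = 1) (ha₀ : ι a₀ = x • w) {φ₀ : A →ₗ[R] R} (hφ₀ : φ₀ a₀ ∉ p) :
    ∃ g : R ⧸ p →ₗ[R] (A →ₗ[R] R) ⧸ LinearMap.range (LinearMap.lcomp R R ι),
      Function.Injective g ∧ IsPseudoZero R (_ ⧸ LinearMap.range g) := by
  have hann := le_annihilator_coker_lcomp hι hιπ
  let q := (LinearMap.range (LinearMap.lcomp R R ι)).mkQ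
  let g := p.liftQ (LinearMap.toSpanSingleton R _ (q φ₀)) fun r hr =>
    Module.mem_annihilator.mp (hann hr) _
  refine ⟨g, (injective_iff_map_eq_zero _).mpr fun r hr => ?_,
    isPseudoZero_of_le_annihilator (ne_of_mem_of_not_mem' hxp hx)
      (hann.trans (LinearMap.annihilator_le_of_surjective _ (Submodule.mkQ_surjective _)))
      fun _ => LocalizedModule.subsingleton_iff.mpr fun z => ⟨φ₀ a₀, hφ₀, ?_⟩⟩
  · obtain ⟨r, rfl⟩ := Ideal.Quotient.mk_surjective r
    obtain ⟨φ, hφ⟩ : r • φ₀ ∈ LinearMap.range (LinearMap.lcomp R R ι) :=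
      (Submodule.Quotient.mk_eq_zero _).mp hr
    have hmul : r * φ₀ a₀ = x * φ w := by
      rw [← smul_eq_mul, ← smul_eq_mul, ← map_smul φ, ← ha₀]
      exact (LinearMap.congr_fun hφ a₀).symm
    exact Ideal.Quotient.eq_zero_iff_mem.mpr
      ((Ideal.IsPrime.mem_or_mem ‹_› (hmul ▸ p.mul_mem_right _ hxp)).resolve_right hφ₀)
  · obtain ⟨z, rfl⟩ := Submodule.mkQ_surjective _ z
    obtain ⟨ψ, rfl⟩ := Submodule.mkQ_surjective _ z
    have hχ : (φ₀ a₀ • ψ - ψ a₀ • φ₀) a₀ = 0 := by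
      simp only [LinearMap.sub_apply, LinearMap.smul_apply, smul_eq_mul, mul_comm, sub_self]
    have hq : q (φ₀ a₀ • ψ) = q (ψ a₀ • φ₀) :=
      (Submodule.Quotient.eq _).mpr (mem_range_lcomp_of_apply_eq_zero hι hιπ hx hxp hw ha₀ hχ)
    rw [← map_smul, ← map_smul]
    exact (Submodule.Quotient.mk_eq_zero _).mpr ⟨Ideal.Quotient.mk p (ψ a₀), hq.symm⟩

variable [Module.Finite R A]

-- In codimension one the cokernel of `B* → A*` is `Ext¹(R ⧸ p, R) ≅ R ⧸ p`.
theorem cls_coker_lcomp [IsIntegrallyClosed R] (hB : IsTorsionFreeInCodimOne R B)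
    (hι : Function.Injective ι) (hιπ : Function.Exact ι π) (hπ : Function.Surjective π)
    (hp : p ≠ ⊥) :
    cls R ((A →ₗ[R] R) ⧸ LinearMap.range (LinearMap.lcomp R R ι)) = cls R (R ⧸ p) := by
  have := Ideal.finiteHeight_of_isNoetherianRing p
  by_cases hht : p.height = 1
  · obtain ⟨x, hxp, hx, hspan⟩ := exists_mem_maximalIdeal_eq_span hht
    obtain ⟨w, hw⟩ := hπ 1
    obtain ⟨a₀, ha₀⟩ := smul_mem_range_of_exact hιπ hxp w
    obtain ⟨φ₀, hφ₀⟩ :=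
      exists_dual_notMem_of_isTorsionFreeInCodimOne hB hι hιπ hht hx hspan hw ha₀
    obtain ⟨g, hg, hcoker⟩ :=
      exists_injective_isPseudoZero_coker_of_dual_notMem hι hιπ hx hxp hw ha₀ hφ₀
    exact (cls_eq_of_isPseudoZero_coker hg hcoker).symm
  · have hlt : ¬ p.height ≤ 1 := fun h => hht (h.antisymm
      (Order.one_le_iff_ne_zero.mpr fun h => hp (Ideal.height_eq_zero_iff_eq_bot.mp h)))
    rw [cls_eq_zero_of_isPseudoZero (isPseudoZero_of_le_annihilator hp
        (le_annihilator_coker_lcomp hι hιπ) fun h => absurd h hlt),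
      cls_eq_zero_of_isPseudoZero (isPseudoZero_of_le_annihilator hp
        (Ideal.annihilator_quotient (I := p)).ge fun h => absurd h hlt)]

variable [Module.Finite R B]

theorem cls_add_cls_dual_of_ne_bot [IsIntegrallyClosed R] (hB : IsTorsionFreeInCodimOne R B)
    (hι : Function.Injective ι) (hιπ : Function.Exact ι π) (hπ : Function.Surjective π)
    (hp : p ≠ ⊥) :
    cls R B + cls R (B →ₗ[R] R) = cls R A + cls R (A →ₗ[R] R) := by
  rw [cls_eq_add hι hιπ hπ, cls_eq_add (lcomp_injective hp hιπ)
    (LinearMap.exact_map_mkQ_range _) (Submodule.mkQ_surjective _),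
    cls_coker_lcomp hB hι hιπ hπ hp, add_assoc, add_comm (cls R (R ⧸ p))]

theorem exists_cls_add_cls_dual_eq_add [IsIntegrallyClosed R] (hB : IsTorsionFreeInCodimOne R B)
    (hι : Function.Injective ι) (hιπ : Function.Exact ι π) (hπ : Function.Surjective π) :
    ∃ k : ℕ, cls R B + cls R (B →ₗ[R] R) =
      cls R A + cls R (A →ₗ[R] R) + (2 * k) • cls R R := by
  by_cases hp : p = ⊥
  · let e := Submodule.quotEquivOfEqBot p hp
    have hιe : Function.Exact ι (e.toLinearMap ∘ₗ π) := fun b => e.map_eq_zero_iff.trans (hιπ b)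
    exact ⟨1, cls_add_cls_dual_of_exact hι hιe (e.surjective.comp hπ)⟩
  · exact ⟨0, by rw [cls_add_cls_dual_of_ne_bot hB hι hιπ hπ hp, mul_zero, zero_nsmul, add_zero]⟩

theorem exists_cls_add_cls_dual [IsIntegrallyClosed R] {N : Type u} [AddCommGroup N] [Module R N]
    [Module.Finite R N] (hN : IsTorsionFreeInCodimOne R N) :
    ∃ k : ℕ, cls R N + cls R (N →ₗ[R] R) = (2 * k) • cls R R := by
  obtain ⟨s, hhead, hlast⟩ := IsNoetherianRing.exists_relSeries_isQuotientEquivQuotientPrime R N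
  have key (i : Fin (s.length + 1)) :
      ∃ k : ℕ, cls R (s i) + cls R (s i →ₗ[R] R) = (2 * k) • cls R R := by
    induction i using Fin.induction with
    | zero =>
      have : Subsingleton (s 0) := (Submodule.subsingleton_iff_eq_bot).mpr hhead
      exact ⟨0, by rw [cls_eq_zero_of_subsingleton, cls_eq_zero_of_subsingleton, add_zero,
        mul_zero, zero_nsmul]⟩
    | succ i ih =>
      obtain ⟨k, hk⟩ := ih
      obtain ⟨hle, p, ⟨e⟩⟩ := s.step i
      let q := ((s i.castSucc).submoduleOf (s i.succ)).mkQ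
      have hexact : Function.Exact (Submodule.inclusion hle) (e.toLinearMap ∘ₗ q) := fun b =>
        e.map_eq_zero_iff.trans (by
          rw [Submodule.mkQ_apply, Submodule.Quotient.mk_eq_zero, ← LinearMap.coe_range,
            Submodule.range_inclusion]
          rfl)
      obtain ⟨l, hl⟩ := exists_cls_add_cls_dual_eq_add
        (hN.of_injective (Submodule.subtype_injective _)) (Submodule.inclusion_injective hle)
        hexact (e.surjective.comp (Submodule.mkQ_surjective _))
      exact ⟨k + l, by rw [hl, hk, mul_add, add_nsmul]⟩
  obtain ⟨k, hk⟩ := key (Fin.last _)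
  let e : s (Fin.last _) ≃ₗ[R] N := LinearEquiv.ofTop _ hlast
  exact ⟨k, by rw [← hk, cls_congr e, cls_congr (e.congrLeft R R)]⟩

end Dual

/-! ### Order units and syzygies -/

section Cone

variable {E F : Type*} [AddCommGroup E] [Module ℝ E] [AddCommGroup F] [Module ℝ F]

theorem IsPolyhedral.map {C : PointedCone ℝ E} (hC : IsPolyhedral C) (f : E →ₗ[ℝ] F) :
    IsPolyhedral (C.map f) := by
  classical
  obtain ⟨t, rfl⟩ := hC
  refine ⟨t.image f, ?_⟩
  rw [Finset.coe_image]
  exact Submodule.map_span (f.restrictScalars {c : ℝ // 0 ≤ c}) (t : Set E)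

/-- `v` is an order unit of the cone `C`: every vector lies in `C - ℝ≥0 v`. -/
def IsOrderUnit (C : PointedCone ℝ E) (v : E) : Prop :=
  ∀ w, ∃ K : ℝ, 0 ≤ K ∧ K • v + w ∈ C

variable {C : PointedCone ℝ E} {v : E}

theorem IsOrderUnit.mem (h : IsOrderUnit C v) : v ∈ C := by
  obtain ⟨K, hK, hmem⟩ := h v
  have hmem : (K + 1) • v ∈ C := by rwa [add_smul, one_smul]
  have hmem := PointedCone.smul_mem C (r := (K + 1)⁻¹) (by positivity) hmem
  rwa [inv_smul_smul₀ (by positivity)] at hmem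

theorem smul_add_mem_of_le (hv : v ∈ C) {w : E} {K b : ℝ} (hKb : K ≤ b) (h : K • v + w ∈ C) :
    b • v + w ∈ C := by
  have hsum := C.add_mem (PointedCone.smul_mem C (sub_nonneg.mpr hKb) hv) h
  rwa [← add_assoc, ← add_smul, sub_add_cancel] at hsum

theorem IsOrderUnit.add_mem (h : IsOrderUnit C v) {v' : E} (hv' : v' ∈ C) :
    IsOrderUnit C (v + v') := fun w => by
  obtain ⟨K, hK, hmem⟩ := h w
  refine ⟨K, hK, ?_⟩
  rw [smul_add, add_right_comm]
  exact C.add_mem hmem (PointedCone.smul_mem C hK hv')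

theorem IsOrderUnit.of_smul {a : ℝ} (ha : 0 ≤ a) (h : IsOrderUnit C (a • v)) :
    IsOrderUnit C v := fun w => by
  obtain ⟨K, hK, hmem⟩ := h w
  exact ⟨K * a, mul_nonneg hK ha, by rwa [mul_smul]⟩

theorem IsOrderUnit.map (h : IsOrderUnit C v) {f : E →ₗ[ℝ] F} (hf : Function.Surjective f) :
    IsOrderUnit (C.map f) (f v) := fun w => by
  obtain ⟨w, rfl⟩ := hf w
  obtain ⟨K, hK, hmem⟩ := h w
  refine ⟨K, hK, ?_⟩
  rw [← map_smul, ← map_add]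
  exact Submodule.mem_map_of_mem hmem

theorem isOrderUnit_of_mem_coneInterior (hv : v ∈ coneInterior C) : IsOrderUnit C v := fun w => by
  let : TopologicalSpace E := moduleTopology ℝ E
  have : IsModuleTopology ℝ E := ⟨rfl⟩
  have : ContinuousSMul ℝ E := IsModuleTopology.toContinuousSMul ℝ E
  have : ContinuousAdd E := IsModuleTopology.toContinuousAdd ℝ E
  have hcont : Continuous fun t : ℝ => v + t • w := by fun_prop
  have hnhds : (C : Set E) ∈ nhds (v + (0 : ℝ) • w) := by
    rw [zero_smul, add_zero]
    exact mem_interior_iff_mem_nhds.mp hv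
  obtain ⟨ε, hε, hball⟩ := Metric.eventually_nhds_iff.mp (hcont.continuousAt.eventually hnhds)
  have hmem : v + (ε / 2) • w ∈ C := hball (by
    rw [Real.dist_0_eq_abs, abs_of_pos (half_pos hε)]
    exact half_lt_self hε)
  refine ⟨(ε / 2)⁻¹, by positivity, ?_⟩
  have hmem := PointedCone.smul_mem C (r := (ε / 2)⁻¹) (by positivity) hmem
  rwa [smul_add, inv_smul_smul₀ (by positivity)] at hmem

/-- The vectors `w` such that both `w` and `-w` lie in `C - ℝ≥0 v`. If this subspace is everything,
then `v` is an order unit of `C`. -/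
def absorbed (C : PointedCone ℝ E) (v : E) : Submodule ℝ E where
  carrier := {w | ∃ K : ℝ, 0 ≤ K ∧ K • v + w ∈ C ∧ K • v - w ∈ C}
  zero_mem' := ⟨0, le_rfl, by simp, by simp⟩
  add_mem' := by
    rintro w w' ⟨K, hK, hadd, hsub⟩ ⟨K', hK', hadd', hsub'⟩
    refine ⟨K + K', add_nonneg hK hK', ?_, ?_⟩
    · rw [add_smul, add_add_add_comm]
      exact C.add_mem hadd hadd'
    · rw [add_smul, add_sub_add_comm]
      exact C.add_mem hsub hsub'
  smul_mem' := by
    rintro r w ⟨K, hK, hadd, hsub⟩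
    refine ⟨|r| * K, by positivity, ?_⟩
    have hadd := PointedCone.smul_mem C (abs_nonneg r) hadd
    have hsub := PointedCone.smul_mem C (abs_nonneg r) hsub
    rw [smul_add, smul_smul] at hadd
    rw [smul_sub, smul_smul] at hsub
    obtain hr | hr := abs_choice r
    · rw [hr] at hadd hsub ⊢
      exact ⟨hadd, hsub⟩
    · rw [hr, neg_smul _ w] at hadd hsub
      rw [hr]
      exact ⟨by rwa [sub_neg_eq_add] at hsub, by rwa [← sub_eq_add_neg] at hadd⟩

theorem isOrderUnit_of_absorbed_eq_top (h : absorbed C v = ⊤) : IsOrderUnit C v := fun w =>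
  have ⟨K, hK, hmem, _⟩ := h.ge (Submodule.mem_top (x := w))
  ⟨K, hK, hmem⟩

end Cone

section Syzygies

variable {R : Type u} [CommRing R]

theorem IsMCM.realClass_mem {M : Type u} [AddCommGroup M] [Module R M] [Module.Finite R M]
    (h : IsMCM R M) : realClass R M ∈ cmCone R :=
  Submodule.subset_span ⟨FGModuleCat.of R M, h, rfl⟩

theorem minimalCover_surjective (M : FGModuleCat.{u} R) :
    Function.Surjective (minimalCover R M) := by
  rw [← LinearMap.range_eq_top, minimalCover, Fintype.range_linearCombination]
  exact (exists_minimalGenerators R M).choose_spec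

variable [IsNoetherianRing R]

theorem realClass_firstSyzygy (M : FGModuleCat.{u} R) :
    realClass R (firstSyzygy R M) = (minGen R M : ℝ) • realClass R R - realClass R M := by
  rw [Nat.cast_smul_eq_nsmul, ← realClass_pi, eq_sub_iff_add_eq]
  exact (realClass_eq_add (Submodule.subtype_injective _) (LinearMap.exact_subtype_ker_map _)
    (minimalCover_surjective M)).symm

theorem syzygy_succ (n : ℕ) (M : FGModuleCat.{u} R) :
    syzygy R (n + 1) M = firstSyzygy R (syzygy R n M) :=
  Function.iterate_succ_apply' _ _ _

/-- The coefficient of `[R]` in the class of the `n`-th syzygy: the alternating sum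
`β (n - 1) - β (n - 2) + ⋯`. -/
noncomputable def bettiSum (M : FGModuleCat.{u} R) : ℕ → ℝ
  | 0 => 0
  | n + 1 => betti R n M - bettiSum M n

theorem realClass_syzygy (n : ℕ) (M : FGModuleCat.{u} R) :
    realClass R (syzygy R n M) =
      bettiSum M n • realClass R R + (-1 : ℝ) ^ n • realClass R M := by
  induction n with
  | zero =>
    rw [bettiSum, zero_smul, pow_zero, one_smul, zero_add]
    rfl
  | succ n ih =>
    rw [syzygy_succ, realClass_firstSyzygy, ih, bettiSum, pow_succ, mul_neg_one, neg_smul,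
      sub_smul, betti, sub_add_eq_sub_sub, sub_eq_add_neg]

theorem hasDepthAt_syzygy (hR : IsCohenMacaulay R) (M : FGModuleCat.{u} R) {q : Ideal R}
    [q.IsPrime] {d n : ℕ} (hdn : d ≤ n) (hd : d ≤ q.height) : HasDepthAt q d (syzygy R n M) := by
  induction n generalizing d with
  | zero =>
    obtain rfl := Nat.le_zero.mp hdn
    exact HasRegularSequence.zero
  | succ n ih =>
    cases d with
    | zero => exact HasRegularSequence.zero
    | succ d =>
      rw [syzygy_succ]
      exact HasDepthAt.kernel (Submodule.subtype_injective _) (LinearMap.exact_subtype_ker_map _)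
        (minimalCover_surjective _) (isMCM_iff.mp hR.isMCM q _ hd)
        (ih (Nat.le_of_succ_le_succ hdn) ((Nat.cast_le.mpr d.le_succ).trans hd))

theorem exists_forall_isMCM_syzygy [FiniteRingKrullDim R] (hR : IsCohenMacaulay R) :
    ∃ d : ℕ, ∀ (M : FGModuleCat.{u} R) (n : ℕ), d ≤ n → IsMCM R (syzygy R n M) := by
  have := Nontrivial.of_finiteRingKrullDim (R := R)
  obtain ⟨m, hmax, hm⟩ := Ideal.exists_isMaximal_height (R := R)
  have := Ideal.finiteHeight_of_isNoetherianRing m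
  obtain ⟨d, hd⟩ := ENat.ne_top_iff_exists.mp (Ideal.height_ne_top hmax.ne_top)
  refine ⟨d, fun M n hn => isMCM_iff.mpr fun q hq k hk => hasDepthAt_syzygy hR M ?_ hk⟩
  have hle : (q.height : WithBot ℕ∞) ≤ m.height :=
    hm ▸ Ideal.height_le_ringKrullDim_of_ne_top hq.ne_top
  rw [WithBot.coe_le_coe, ← hd] at hle
  exact (Nat.cast_le.mp (hk.trans hle)).trans hn

theorem isOrderUnit_cmCone [FiniteRingKrullDim R] (hR : IsCohenMacaulay R) :
    IsOrderUnit (cmCone R) (realClass R R) := by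
  refine isOrderUnit_of_absorbed_eq_top (eq_top_of_forall_realClass_mem fun X => ?_)
  obtain ⟨d, hd⟩ := exists_forall_isMCM_syzygy hR
  have hmem (n : ℕ) (hn : d ≤ n) (K : ℝ) (hK : bettiSum X n ≤ K) :
      K • realClass R R + (-1 : ℝ) ^ n • realClass R X ∈ cmCone R :=
    smul_add_mem_of_le hR.isMCM.realClass_mem hK (by
      rw [← realClass_syzygy]
      exact (hd X n hn).realClass_mem)
  obtain ⟨K, hK⟩ := (({0, bettiSum X (2 * d), bettiSum X (2 * d + 1)} : Finset ℝ)).bddAbove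
  refine ⟨K, hK (by simp), ?_, ?_⟩
  · have heven := hmem (2 * d) (by omega) K (hK (by simp))
    rwa [pow_mul, neg_one_sq, one_pow, one_smul] at heven
  · have hodd := hmem (2 * d + 1) (by omega) K (hK (by simp))
    rwa [pow_succ, pow_mul, neg_one_sq, one_pow, one_mul, neg_smul, one_smul,
      ← sub_eq_add_neg] at hodd

theorem complexity_le_one_of_eventually_bettiSum_le {M : FGModuleCat.{u} R} {K : ℝ}
    (h : ∀ᶠ n in Filter.atTop, bettiSum M n ≤ K) : complexity R M ≤ (1 : ℕ) := by
  refine iInf₂_le 1 ⟨|2 * K|, abs_nonneg _, ?_⟩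
  filter_upwards [h, (Filter.tendsto_add_atTop_nat 1).eventually h] with n hn hn'
  rw [bettiSum] at hn'
  rw [Nat.cast_one, sub_self, zpow_zero, mul_one]
  exact le_trans (by linarith) (le_abs_self _)

theorem infinite_setOf_realClass_syzygy_mem {V : PointedCone ℝ (HReal R)}
    (hV : IsOrderUnit V (realClass R R)) {M : FGModuleCat.{u} R} (hM : 2 ≤ complexity R M) :
    {n : ℕ | realClass R (syzygy R n M) ∈ V}.Infinite := by
  obtain ⟨K₁, -, hK₁⟩ := hV (realClass R M)
  obtain ⟨K₂, -, hK₂⟩ := hV (-realClass R M)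
  have hmem (n : ℕ) (hn : max K₁ K₂ ≤ bettiSum M n) : realClass R (syzygy R n M) ∈ V := by
    rw [realClass_syzygy]
    rcases neg_one_pow_eq_or ℝ n with h | h
    · rw [h, one_smul]
      exact smul_add_mem_of_le hV.mem ((le_max_left _ _).trans hn) hK₁
    · rw [h, neg_smul, one_smul]
      exact smul_add_mem_of_le hV.mem ((le_max_right _ _).trans hn) hK₂
  refine Nat.frequently_atTop_iff_infinite.mp fun hnot => ?_
  have hle : complexity R M ≤ (1 : ℕ) := complexity_le_one_of_eventually_bettiSum_le
    (hnot.mono fun n hn => (not_le.mp (mt (hmem n) hn)).le)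
  exact absurd (hM.trans hle) (by norm_num)

end Syzygies

section Extension

variable {R S : Type u} [CommRing R] [CommRing S] [Algebra R S] [IsNoetherianRing R]
  [IsIntegrallyClosed R] [FaithfulSMul R S] [Module.Finite R S]

theorem imageCone_le_cmCone [IsDomain S] : imageCone R S ≤ cmCone R := by
  refine (Submodule.map_span_le _ _ _).mpr ?_
  rintro _ ⟨X, hX, rfl⟩
  let : Module R X := Module.compHom X (algebraMap R S)
  have : IsScalarTower R S X := IsScalarTower.of_algebraMap_smul fun _ _ => rfl
  have : Module.Finite R X := Module.Finite.trans S X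
  change realRestrict R S (realClass S X) ∈ cmCone R
  rw [realRestrict_realClass]
  exact (IsMCM.restrictScalars hX).realClass_mem

theorem isOrderUnit_imageCone [IsDomain R] {N : Type u} [AddCommGroup N] [Module R N]
    [Module S N] [IsScalarTower R S N] [Module.Finite S N] (hN : IsTorsionFreeInCodimOne R N)
    (h : IsOrderUnit (cmCone S) (realClass S (N × RDual R S N))) :
    IsOrderUnit (imageCone R S) (realClass R R) := by
  have : Module.Finite R N := Module.Finite.trans S N
  have : Module.Finite R (RDual R S N) := Module.Finite.trans S _
  obtain ⟨k, hk⟩ := exists_cls_add_cls_dual hN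
  have hdual : realClass R (N × RDual R S N) = ((2 * k : ℕ) : ℝ) • realClass R R := by
    rw [← toReal_cls, cls_prod, Nat.cast_smul_eq_nsmul, ← toReal_cls, ← map_nsmul]
    exact congrArg _ hk
  refine IsOrderUnit.of_smul (Nat.cast_nonneg (2 * k)) ?_
  rw [← hdual, ← realRestrict_realClass R S]
  exact h.map (realRestrict_surjective R S)

end Extension

end GrothendieckCone

theorem theorem1p2_general (R S : Type u) [CommRing R] [CommRing S]
    [IsDomain R] [IsNoetherianRing R] [IsIntegrallyClosed R]
    [IsDomain S] [FiniteRingKrullDim S]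
    [Algebra R S] [FaithfulSMul R S] [Module.Finite R S]
    (hS : GrothendieckCone.IsCohenMacaulay S) :
    Function.Surjective (GrothendieckCone.realRestrict R S) ∧
    (GrothendieckCone.IsPolyhedral (GrothendieckCone.cmCone S) →
      GrothendieckCone.IsPolyhedral (GrothendieckCone.imageCone R S)) ∧
    GrothendieckCone.imageCone R S ≤ GrothendieckCone.cmCone R ∧
    ∀ M : FGModuleCat.{u} R, 2 ≤ GrothendieckCone.complexity R M →
      ((∃ (N : Type u) (_ : AddCommGroup N) (_ : Module R N) (_ : Module S N)
          (_ : IsScalarTower R S N) (_ : Module.Finite S N),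
          GrothendieckCone.IsLocallyFreeInCodimOne R N ∧
          GrothendieckCone.realClass S (N × GrothendieckCone.RDual R S N) ∈
            GrothendieckCone.coneInterior (GrothendieckCone.cmCone S)) ∨
        GrothendieckCone.IsMCM R (S →ₗ[R] R)) →
      {n : ℕ | GrothendieckCone.realClass R (GrothendieckCone.syzygy R n M) ∈
        GrothendieckCone.imageCone R S}.Infinite := by
  open GrothendieckCone in
  refine ⟨realRestrict_surjective R S, fun hpoly => hpoly.map _, imageCone_le_cmCone,
    fun M hM hcond => infinite_setOf_realClass_syzygy_mem ?_ hM⟩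
  obtain ⟨N, _, _, _, _, _, hN, hint⟩ | hdual := hcond
  · exact isOrderUnit_imageCone hN.isTorsionFreeInCodimOne (isOrderUnit_of_mem_coneInterior hint)
  · have hmcm : IsMCM R (RDual R S S) := hdual
    have : IsNoetherianRing S := .of_finite R S
    refine isOrderUnit_imageCone (N := S) isTorsionFreeInCodimOne ?_
    rw [realClass_prod]
    exact (isOrderUnit_cmCone hS).add_mem hmcm.of_restrictScalars.realClass_mem

theorem theorem1p2 (R S : Type u) [CommRing R] [CommRing S]
    [IsDomain R] [IsLocalRing R] [IsNoetherianRing R]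
    [IsDomain S] [IsLocalRing S] [IsNoetherianRing S]
    [Algebra R S] [FaithfulSMul R S] [Module.Finite R S] [IsIntegrallyClosed R]
    (hR : GrothendieckCone.IsCohenMacaulay R) (hS : GrothendieckCone.IsCohenMacaulay S)
    (hfin : FiniteDimensional ℝ (GrothendieckCone.HReal S))
    (hpoly : GrothendieckCone.IsPolyhedral (GrothendieckCone.cmCone S)) :
    Function.Surjective (GrothendieckCone.realRestrict R S) ∧
    GrothendieckCone.IsPolyhedral (GrothendieckCone.imageCone R S) ∧
    GrothendieckCone.imageCone R S ≤ GrothendieckCone.cmCone R ∧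
    ∀ M : FGModuleCat.{u} R, 2 ≤ GrothendieckCone.complexity R M →
      GrothendieckCone.IsLocallyFreeInCodimOne R M →
      ((∃ (N : Type u) (_ : AddCommGroup N) (_ : Module R N) (_ : Module S N)
          (_ : IsScalarTower R S N) (_ : Module.Finite S N),
          GrothendieckCone.IsLocallyFreeInCodimOne R N ∧
          GrothendieckCone.realClass S (N × GrothendieckCone.RDual R S N) ∈
            GrothendieckCone.coneInterior (GrothendieckCone.cmCone S)) ∨
        GrothendieckCone.IsMCM R (S →ₗ[R] R)) →
      {n : ℕ | GrothendieckCone.realClass R (GrothendieckCone.syzygy R n M) ∈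
        GrothendieckCone.imageCone R S}.Infinite := by
  obtain ⟨hsurj, hmap, hle, hinf⟩ := theorem1p2_general R S hS
  exact ⟨hsurj, hmap hpoly, hle, fun M hM _ => hinf M hM⟩
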